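/- Let $F$ be a non-archimedean local field of characteristic $0$ with ring of integers $\mathfrak o$, prime element $\varpi$ and residue field of $q$ elements. Let $\mathcal H_n(\mathfrak o)$ be the set of half-integral symmetric matrices of degree $n$ over $F$, i.e. $b_{ii}\in\mathfrak o$ and $2b_{ij}\in\mathfrak o$ for $i\ne j$. Write $A[X]={}^tXAX$, and let $\mathrm{vol}$ be the Haar measure on integral matrices normalized by $\mathrm{vol}(M_{mn}(\mathfrak o))=1$ (and the product measure on pairs of such matrices). A matrix $X\in M_{ml}(\mathfrak o)$ is called primitive if $(X\ Y)\in GL_m(\mathfrak o)$ for some $Y\in M_{m,m-l}(\mathfrak o)$. For a symmetric matrix $S$ of degree $m$ over $F$, $T\in\mathcal H_{n}(\mathfrak o)$ and $0\le l\le n$, let $$\beta(S,T)^{(l)}=\lim_{e\to\infty}q^{en(n+1)/2}\,\mathrm{vol}\{X\in M_{mn}(\mathfrak o): S[X]-T\in\varpi^e\mathcal H_n(\mathfrak o),\ \text{the last } l \text{ columns of } X \text{ form a primitive matrix}\},$$ and $\beta(S,T)=\beta(S,T)^{(n)}$. For $T\in\mathcal H_{n-r}(\mathfrak o)$, $R\in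 M_{r,n-r}(\mathfrak o)$ and $A\in\mathcal H_r(\mathfrak o)$ let $$\alpha(S,T,R,A)=\lim_{e\to\infty}q^{e(n-r)(n-r+1)/2}\,\mathrm{vol}\left\{(X_1,X_2)\in M_{m,n-r}(\mathfrak o)\times M_{r,n-r}(\mathfrak o): S[X_1]-\begin{pmatrix}T&2^{-1}\,{}^tR\\2^{-1}R&A\end{pmatrix}\begin{bmatrix}1_{n-r}\\X_2\end{bmatrix}\in\varpi^e\mathcal H_{n-r}(\mathfrak o)\right\}.$$ Let $H_k$ be the orthogonal sum of $k$ copies of $\begin{pmatrix}0&1/2\\1/2&0\end{pmatrix}$. **Theorem.** Let $0\le r\le n$ and $k\ge r$ be integers, and let $B=\begin{pmatrix}T&2^{-1}\,{}^tR\\2^{-1}R&A\end{pmatrix}$ be non-degenerate, with $T\in\mathcal H_{n-r}(\mathfrak o)$, $R\in M_{r,n-r}(\mathfrak o)$ and $A\in\mathcal H_r(\mathfrak o)$. Then the limits defining $\alpha(H_{k-r},T,\varpi R,\varpi^2A)$, $\beta(H_k,\varpi^2A)$ and $\beta(H_k,B[1_{n-r}\bot\varpi1_r])^{(r)}$ exist,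 and $$\beta(H_k,B[1_{n-r}\bot\varpi 1_r])^{(r)}=\beta(H_k,\varpi^2A)\,\alpha(H_{k-r},T,\varpi R,\varpi^2A).$$ -/

import Mathlib

open scoped ValuativeRel

noncomputable section

namespace LocalDensity

open Matrix Filter Topology MeasureTheory

/-- The compact additive group of integral matrices. -/
instance instCompactSpaceMatrix {R ι κ : Type*} [TopologicalSpace R] [CompactSpace R] :
    CompactSpace (Matrix ι κ R) :=
  inferInstanceAs (CompactSpace (ι → κ → R))

/-- The volume of a subset `C` of a compact additive group with respect to the Haar measure of
total mass one. On `M_{mn}(𝔬)` (or on a product of two such groups) this is the restriction of the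
Haar measure of `M_{mn}(F)` for which `M_{mn}(𝔬)` has volume one (or the product of two such
measures). -/
def vol {G : Type*} [AddGroup G] [TopologicalSpace G] [IsTopologicalAddGroup G] [CompactSpace G]
    (C : Set G) : ℝ :=
  letI : MeasurableSpace G := borel G
  haveI : BorelSpace G := ⟨rfl⟩
  (Measure.addHaarMeasure (⊤ : TopologicalSpace.PositiveCompacts G)).real C

/-- `A[X] = ᵗX A X`. -/
def act {R μ ν : Type*} [CommRing R] [Fintype μ] (A : Matrix μ μ R) (X : Matrix μ ν R) :
    Matrix ν ν R :=
  Xᵀ * A * X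

/-- A matrix `X` of type `(m, n)` is primitive if it can be completed by a matrix `Y` of type
`(m, m - n)` to an invertible matrix `(X Y)` (there is no such completion if `m < n`, as then the
block `Y` is empty and `X` itself would have to be invertible). -/
def IsPrimitive {R μ κ : Type*} [CommRing R] [Fintype μ] [DecidableEq μ] [Fintype κ]
    [DecidableEq κ] (X : Matrix μ κ R) : Prop :=
  ∃ (Y : Matrix μ (Fin (Fintype.card μ - Fintype.card κ)) R)
    (Z : Matrix (κ ⊕ Fin (Fintype.card μ - Fintype.card κ)) μ R),
    fromCols X Y * Z = 1 ∧ Z * fromCols X Y = 1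

/-- `H_k`, the orthogonal sum of `k` copies of the matrix `H` with rows `(0, 1/2)` and
`(1/2, 0)`. -/
def hyperbolic (F : Type*) [Field F] (k : ℕ) : Matrix (Fin 2 × Fin k) (Fin 2 × Fin k) F :=
  blockDiagonal fun _ : Fin k => !![0, 2⁻¹; 2⁻¹, 0]

variable {F : Type*} [Field F] [ValuativeRel F]

/-- An integral matrix, viewed as a matrix over the field `F`. -/
def toField {ι κ : Type*} (X : Matrix ι κ 𝒪[F]) : Matrix ι κ F :=
  X.map fun x : 𝒪[F] => (x : F)

/-- The set `H_n(𝔬)` of half-integral matrices: symmetric matrices with integral diagonal whose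
other entries become integral after multiplication by `2`. -/
def halfIntegral (F : Type*) [Field F] [ValuativeRel F] (ν : Type*) : Set (Matrix ν ν F) :=
  {B | B.IsSymm ∧ (∀ i, B i i ∈ 𝒪[F]) ∧ ∀ i j, i ≠ j → 2 * B i j ∈ 𝒪[F]}

/-- The set `ϖ ^ e H_n(𝔬)`. -/
def scaledHalfIntegral (ϖ : 𝒪[F]) (e : ℕ) (ν : Type*) : Set (Matrix ν ν F) :=
  {B | ∃ C ∈ halfIntegral F ν, B = (ϖ : F) ^ e • C}

/-- The symmetric block matrix with rows `(T, 2⁻¹ ᵗR)` and `(2⁻¹ R, A)`. -/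
def blockForm {σ ρ : Type*} (T : Matrix σ σ F) (R : Matrix ρ σ 𝒪[F]) (A : Matrix ρ ρ F) :
    Matrix (σ ⊕ ρ) (σ ⊕ ρ) F :=
  fromBlocks T ((2⁻¹ : F) • (toField R)ᵀ) ((2⁻¹ : F) • toField R) A

section Sets

variable {μ ν κ σ ρ : Type*} [Fintype μ] [DecidableEq μ] [Fintype κ] [DecidableEq κ] [Fintype σ]
  [DecidableEq σ] [Fintype ρ]

/-- The set `𝒜_e(S, T, R, A)` of pairs `(X₁, X₂)` of integral matrices such that
`S[X₁] - (T, 2⁻¹ ᵗR; 2⁻¹ R, A)[1; X₂]` lies in `ϖ ^ e H(𝔬)`. -/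
def modifiedSet (ϖ : 𝒪[F]) (e : ℕ) (S : Matrix μ μ F) (T : Matrix σ σ F) (R : Matrix ρ σ 𝒪[F])
    (A : Matrix ρ ρ F) : Set (Matrix μ σ 𝒪[F] × Matrix ρ σ 𝒪[F]) :=
  {X | act S (toField X.1) - act (blockForm T R A) (toField (fromRows 1 X.2))
    ∈ scaledHalfIntegral ϖ e σ}

/-- The set of integral `X` with `S[X] - T ∈ ϖ ^ e H(𝔬)` such that the submatrix consisting of
the columns listed by `c` is primitive. -/
def primitiveSet (ϖ : 𝒪[F]) (e : ℕ) (S : Matrix μ μ F) (T : Matrix ν ν F) (c : κ → ν) :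
    Set (Matrix μ ν 𝒪[F]) :=
  {X | act S (toField X) - T ∈ scaledHalfIntegral ϖ e ν ∧ IsPrimitive (X.submatrix id c)}

end Sets

section Densities

variable {μ ν κ σ ρ : Type*} [Fintype μ] [DecidableEq μ] [Fintype ν] [Fintype κ] [DecidableEq κ]
  [Fintype σ] [DecidableEq σ] [Fintype ρ] [TopologicalSpace F] [IsNonarchimedeanLocalField F]

/-- The normalised volume `q ^ (e n (n + 1) / 2) vol(𝒜_e(S, T, R, A))`, where `n` is the size
of `T`. -/
def modifiedVol (ϖ : 𝒪[F]) (S : Matrix μ μ F) (T : Matrix σ σ F) (R : Matrix ρ σ 𝒪[F])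
    (A : Matrix ρ ρ F) (e : ℕ) : ℝ :=
  (Nat.card 𝓀[F] : ℝ) ^ (e * (Fintype.card σ * (Fintype.card σ + 1) / 2)) *
    vol (modifiedSet ϖ e S T R A)

/-- The modified local density `α(S, T, R, A)`: the limit of the normalised volumes (meaningful
only where that limit exists). -/
def modifiedDensity (ϖ : 𝒪[F]) (S : Matrix μ μ F) (T : Matrix σ σ F) (R : Matrix ρ σ 𝒪[F])
    (A : Matrix ρ ρ F) : ℝ :=
  limUnder atTop (modifiedVol ϖ S T R A)

/-- The normalised volume `q ^ (e n (n + 1) / 2) vol(ℬ_e(S, T))`, where `n` is the size of `T`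
and the columns listed by `c` have to form a primitive matrix. -/
def primitiveVol (ϖ : 𝒪[F]) (S : Matrix μ μ F) (T : Matrix ν ν F) (c : κ → ν) (e : ℕ) : ℝ :=
  (Nat.card 𝓀[F] : ℝ) ^ (e * (Fintype.card ν * (Fintype.card ν + 1) / 2)) *
    vol (primitiveSet ϖ e S T c)

/-- The limit of the normalised volumes (meaningful only where that limit exists). For columns
`c = Sum.inr : Fin l → Fin s ⊕ Fin l` (the last `l` of the `s + l` columns) this is the modified
primitive local density `β(S, T)^{(l)}`; for `c = id` (all columns) it is the primitive local
density `β(S, T)`. -/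
def primitiveDensity (ϖ : 𝒪[F]) (S : Matrix μ μ F) (T : Matrix ν ν F) (c : κ → ν) : ℝ :=
  limUnder atTop (primitiveVol ϖ S T c)

end Densities

end LocalDensity

end

/-! Half-integral symmetric matrices are integral quadratic forms, that is, square matrices over
`𝒪[F]` modulo alternating ones (`FormEq`). In this language residue characteristic 2 needs no
separate treatment. A system of vectors in `H_k` is a pair `(u, v)` of matrices with form `uᵀ * v`,
so each volume is a normalized count of solutions over the finite local ring `𝒪[F] / ϖ ^ e`.

The identity already holds at every level `e ≥ 1` (`normCount_fromBlocks`). A solution for the whole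
form restricts to its last `r` columns `(a, b)`, a primitive representation of `ϖ²A`. The fibre
consists of the remaining columns with prescribed form and prescribed inner products with `(a, b)`.
Its size does not depend on `(a, b)` (`card_fiberSet`): as `ϖ²A` vanishes modulo `ϖ`, the reduced
columns span a totally isotropic space, and exchanging coordinates inside hyperbolic planes, which
is an isometry, makes `a` itself primitive. Completing `a` to a basis and solving the linear
conditions then leaves `H_{k-r}` together with a free matrix `x`, which is exactly the set counted
by `α`.

Convergence is eventual constancy. A count where all columns are primitive is stable from level 1 by
a first-order lifting argument (`card_solutionSet_le_add`). When only some columns are primitive,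
non-degeneracy lets a small perturbation of the form be absorbed by a change of variables near the
identity (`card_solutionSet_add_of_det_dvd`). The normalized volume for `α` is the quotient of these
two, the divisor being nonzero since `r ≤ k`. -/

noncomputable section

namespace LocalDensity

open Matrix IsLocalRing

/-! ### Quadratic forms as matrices modulo alternating matrices -/

section FormEq

variable {R R' ν σ ρ : Type*} [CommRing R] [CommRing R']

/-- Two square matrices define the same quadratic form, i.e. they differ by an alternating
matrix. -/
def FormEq (D D' : Matrix ν ν R) : Prop :=
  ∃ L : Matrix ν ν R, D = D' + (L - Lᵀ)

lemma formEq_iff {D D' : Matrix ν ν R} :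
    FormEq D D' ↔ (∀ i, D i i = D' i i) ∧ ∀ i j, i ≠ j → D i j + D j i = D' i j + D' j i := by
  classical
  constructor
  · rintro ⟨L, rfl⟩
    refine ⟨fun i => by simp, fun i j _ => ?_⟩
    simp only [Matrix.add_apply, Matrix.sub_apply, transpose_apply]
    ring
  · rintro ⟨h1, h2⟩
    let : LinearOrder ν := IsWellOrder.linearOrder WellOrderingRel
    -- The strictly upper triangular part of the difference suffices: the polar condition forces the
    -- entries below the diagonal to be its negatives.
    refine ⟨Matrix.of fun i j => if i < j then D i j - D' i j else 0, ?_⟩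
    ext i j
    simp only [Matrix.add_apply, Matrix.sub_apply, transpose_apply, of_apply]
    rcases lt_trichotomy i j with h | rfl | h
    · simp [h, h.le.not_gt]
    · simp [h1]
    · simp only [h, if_true, h.le.not_gt, if_false]
      linear_combination h2 i j h.ne'

namespace FormEq

lemma refl (D : Matrix ν ν R) : FormEq D D := ⟨0, by simp⟩

lemma symm {D D' : Matrix ν ν R} (h : FormEq D D') : FormEq D' D := by
  obtain ⟨L, rfl⟩ := h
  exact ⟨-L, by rw [transpose_neg]; abel⟩

lemma trans {D D' D'' : Matrix ν ν R} (h : FormEq D D') (h' : FormEq D' D'') :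
    FormEq D D'' := by
  obtain ⟨L, rfl⟩ := h
  obtain ⟨L', rfl⟩ := h'
  exact ⟨L + L', by rw [transpose_add]; abel⟩

lemma add {D D' E E' : Matrix ν ν R} (h : FormEq D D') (h' : FormEq E E') :
    FormEq (D + E) (D' + E') := by
  obtain ⟨L, rfl⟩ := h
  obtain ⟨L', rfl⟩ := h'
  exact ⟨L + L', by rw [transpose_add]; abel⟩

lemma transpose_self (D : Matrix ν ν R) : FormEq Dᵀ D := ⟨Dᵀ, by simp⟩

lemma map {D D' : Matrix ν ν R} (h : FormEq D D') (f : R →+* R') :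
    FormEq (D.map f) (D'.map f) := by
  rw [formEq_iff] at h ⊢
  refine ⟨fun i => congrArg f (h.1 i), fun i j hij => ?_⟩
  simpa using congrArg f (h.2 i j hij)

lemma congr_act [Fintype ν] {D D' : Matrix ν ν R} (h : FormEq D D') (U : Matrix ν σ R) :
    FormEq (Uᵀ * D * U) (Uᵀ * D' * U) := by
  obtain ⟨L, rfl⟩ := h
  exact ⟨Uᵀ * L * U, by simp [Matrix.mul_add, Matrix.add_mul, Matrix.mul_sub, Matrix.sub_mul,
    Matrix.mul_assoc]⟩

end FormEq

lemma formEq_iff_of_formEq_right {D E E' : Matrix ν ν R} (h : FormEq E E') :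
    FormEq D E ↔ FormEq D E' :=
  ⟨fun h' => h'.trans h, fun h' => h'.trans h.symm⟩

lemma formEq_iff_of_formEq_left {D D' E : Matrix ν ν R} (h : FormEq D D') :
    FormEq D E ↔ FormEq D' E :=
  ⟨fun h' => h.symm.trans h', fun h' => h.trans h'⟩

lemma formEq_add_right {D D' E : Matrix ν ν R} :
    FormEq (D + E) (D' + E) ↔ FormEq D D' := by
  refine ⟨fun h => ?_, fun h => h.add (.refl E)⟩
  simpa using h.add (FormEq.refl (-E))

/-- A form on a direct sum amounts to its two restrictions and the pairing between the summands, so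
one off-diagonal block can always be normalized to zero. -/
lemma formEq_fromBlocks {D D' : Matrix σ σ R} {B B' : Matrix σ ρ R} {P P' : Matrix ρ σ R}
    {C C' : Matrix ρ ρ R} :
    FormEq (fromBlocks D B P C) (fromBlocks D' B' P' C') ↔
      FormEq D D' ∧ FormEq C C' ∧ P + Bᵀ = P' + B'ᵀ := by
  simp only [formEq_iff]
  constructor
  · rintro ⟨h1, h2⟩
    refine ⟨⟨fun i => h1 (.inl i), fun i j hij => h2 (.inl i) (.inl j) (by simpa)⟩,
      ⟨fun i => h1 (.inr i), fun i j hij => h2 (.inr i) (.inr j) (by simpa)⟩, ?_⟩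
    ext i j
    exact h2 (.inr i) (.inl j) (by simp)
  · rintro ⟨⟨h1, h2⟩, ⟨h3, h4⟩, h5⟩
    have h5' : ∀ i j, P i j + B j i = P' i j + B' j i := fun i j => congrFun₂ h5 i j
    refine ⟨?_, ?_⟩
    · rintro (i | i)
      exacts [h1 i, h3 i]
    · rintro (i | i) (j | j) hij
      · exact h2 i j (by simpa using hij)
      · simpa [add_comm] using h5' j i
      · simpa using h5' i j
      · exact h4 i j (by simpa using hij)

end FormEq

/-! ### Primitive matrices and left inverses over local rings -/

section LeftInverse

variable {R R' κ ρ : Type*} [CommRing R] [CommRing R'] [Fintype κ] [DecidableEq ρ]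

/-- A matrix over a ring has a left inverse. -/
def HasLeftInverse (X : Matrix κ ρ R) : Prop :=
  ∃ Z : Matrix ρ κ R, Z * X = 1

lemma HasLeftInverse.map {X : Matrix κ ρ R} (h : HasLeftInverse X) (f : R →+* R') :
    HasLeftInverse (X.map f) := by
  obtain ⟨Z, hZ⟩ := h
  exact ⟨Z.map f, by rw [← Matrix.map_mul, hZ]; simp⟩

variable [Fintype ρ]

lemma hasLeftInverse_of_isUnit_det {X : Matrix κ ρ R} (Z : Matrix ρ κ R)
    (h : IsUnit (Z * X).det) : HasLeftInverse X :=
  ⟨(Z * X)⁻¹ * Z, by rw [Matrix.mul_assoc, Matrix.nonsing_inv_mul _ h]⟩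

/-- Any lift `Z` of a left inverse makes `Z * X` have a determinant that maps to 1, hence a unit
because `f` is local. Primitivity can thus be tested modulo the maximal ideal. -/
lemma hasLeftInverse_map_iff {X : Matrix κ ρ R} (f : R →+* R') [IsLocalHom f]
    (hf : Function.Surjective f) : HasLeftInverse (X.map f) ↔ HasLeftInverse X := by
  refine ⟨fun ⟨Z, hZ⟩ => ?_, fun h => h.map f⟩
  obtain ⟨Z, rfl⟩ : ∃ Z' : Matrix ρ κ R, Z'.map f = Z :=
    ⟨Z.map (Function.surjInv hf), by ext; simp [Function.surjInv_eq hf]⟩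
  refine hasLeftInverse_of_isUnit_det Z ((isUnit_map_iff f _).mp ?_)
  rw [RingHom.map_det, RingHom.mapMatrix_apply, Matrix.map_mul, hZ]
  simp

/-- Over a field, a matrix with trivial kernel has a left inverse. -/
lemma hasLeftInverse_of_ker_eq_bot {K : Type*} [Field K] {X : Matrix κ ρ K}
    (h : X.mulVecLin.ker = ⊥) : HasLeftInverse X := by
  classical
  obtain ⟨g, hg⟩ := LinearMap.exists_leftInverse_of_injective _ h
  refine ⟨LinearMap.toMatrix' g, ?_⟩
  have := congrArg LinearMap.toMatrix' hg
  rwa [LinearMap.toMatrix'_comp, ← Matrix.toLin'_apply', LinearMap.toMatrix'_toLin',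
    LinearMap.toMatrix'_id] at this

/-- A left inverse splits the free module as the range of `X` plus the kernel of `Z`. This kernel is
finitely generated projective, hence free over a local ring, and a basis of it supplies the missing
columns. -/
lemma isPrimitive_iff_hasLeftInverse [IsLocalRing R] [DecidableEq κ] {X : Matrix κ ρ R} :
    IsPrimitive X ↔ HasLeftInverse X := by
  constructor
  · rintro ⟨Y, Z, -, h⟩
    refine ⟨Z.toRows₁, ?_⟩
    ext i j
    have := congrFun₂ h (.inl i) (.inl j)
    simpa [Matrix.mul_apply, Matrix.one_apply] using this
  · rintro ⟨Z, hZ⟩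
    let f := Matrix.toLin' X
    let g := Matrix.toLin' Z
    have hgf : ∀ x, g (f x) = x := fun x => by
      simp only [f, g, ← Matrix.toLin'_mul_apply, hZ, Matrix.toLin'_one, LinearMap.id_apply]
    have hc : IsCompl f.range g.ker := by
      constructor
      · rw [Submodule.disjoint_def]
        rintro _ ⟨y, rfl⟩ hy
        rw [LinearMap.mem_ker, hgf] at hy
        rw [hy, map_zero]
      · rw [codisjoint_iff, eq_top_iff]
        intro x _
        rw [← add_sub_cancel (f (g x)) x]
        refine Submodule.add_mem_sup ⟨g x, rfl⟩ ?_
        rw [LinearMap.mem_ker, map_sub, hgf, sub_self]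
    let e₁ : (ρ → R) ≃ₗ[R] f.range :=
      LinearEquiv.ofInjective f (Function.LeftInverse.injective hgf)
    let e₂ : ((ρ → R) × g.ker) ≃ₗ[R] (κ → R) :=
      (e₁.prodCongr (.refl R _)).trans (Submodule.prodEquivOfIsCompl _ _ hc)
    have hproj : Module.Projective R g.ker := by
      refine Module.Projective.of_split (M := κ → R) g.ker.subtype
        (LinearMap.snd R _ _ ∘ₗ e₂.symm.toLinearMap) ?_
      ext x : 1
      have : e₂.symm x = (0, x) := by rw [LinearEquiv.symm_apply_eq]; simp [e₂]
      simp [this]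
    have hfin : Module.Finite R g.ker :=
      Module.Finite.of_surjective (LinearMap.snd R (ρ → R) g.ker ∘ₗ e₂.symm.toLinearMap)
        (Prod.snd_surjective.comp e₂.symm.surjective)
    have hfree : Module.Free R g.ker := Module.free_of_flat_of_isLocalRing
    have hrank : Module.finrank R g.ker = Fintype.card κ - Fintype.card ρ := by
      have := e₂.finrank_eq
      rw [Module.finrank_prod, Module.finrank_fintype_fun_eq_card,
        Module.finrank_fintype_fun_eq_card] at this
      omega
    let b := Module.finBasisOfFinrankEq R g.ker hrank
    let E : (ρ ⊕ Fin (Fintype.card κ - Fintype.card ρ) → R) ≃ₗ[R] (κ → R) :=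
      (LinearEquiv.sumArrowLequivProdArrow _ _ R R).trans
        (((LinearEquiv.refl R _).prodCongr b.equivFun.symm).trans e₂)
    have hX : fromCols X (LinearMap.toMatrix' E.toLinearMap).toCols₂ =
        LinearMap.toMatrix' E.toLinearMap := by
      conv_rhs => rw [← fromCols_toCols (LinearMap.toMatrix' E.toLinearMap)]
      congr 1
      ext i j
      have : E (Pi.single (Sum.inl j) 1) = f (Pi.single j 1) := by
        simp only [E, LinearEquiv.trans_apply, LinearEquiv.sumArrowLequivProdArrow]
        simp only [e₂, e₁, LinearEquiv.trans_apply]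
        simp
        congr 1
        ext x
        simp [Equiv.sumArrowEquivProdArrow, Pi.single_apply]
      simp [toCols₁, LinearMap.toMatrix'_apply, this, f]
    refine ⟨(LinearMap.toMatrix' E.toLinearMap).toCols₂,
      LinearMap.toMatrix' E.symm.toLinearMap, ?_, ?_⟩
    · rw [hX, ← LinearMap.toMatrix'_comp, E.comp_symm, LinearMap.toMatrix'_id]
    · rw [hX, ← LinearMap.toMatrix'_comp, E.symm_comp, LinearMap.toMatrix'_id]

end LeftInverse

/-! ### Independence of the fibre from the chosen isotropic columns -/

section Fiber

variable {R κ lam σ ρ : Type*}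

/-- Exchange the `i`-th rows of two matrices, and return the new first matrix. -/
def swapRow [DecidableEq κ] (i : κ) (a b : Matrix κ ρ R) : Matrix κ ρ R :=
  of fun x j => if x = i then b x j else a x j

lemma swapRow_swapRow [DecidableEq κ] (i : κ) (a b : Matrix κ ρ R) :
    swapRow i (swapRow i a b) (swapRow i b a) = a := by
  ext x j
  by_cases h : x = i <;> simp [swapRow, h]

variable [CommRing R]

lemma swapRow_map {R' : Type*} [CommRing R'] [DecidableEq κ] (i : κ) (a b : Matrix κ ρ R)
    (f : R →+* R') : (swapRow i a b).map f = swapRow i (a.map f) (b.map f) := by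
  ext x j
  by_cases h : x = i <;> simp [swapRow, h]

variable [Fintype κ]

/-- For a hyperbolic space written as the sum of two dual totally singular spaces, the set of
systems of vectors `(u, v)` which represent the form `D` and have the inner products `P` with the
system `(a, b)`. -/
def fiberSet (a b : Matrix κ ρ R) (D : Matrix σ σ R) (P : Matrix ρ σ R) :
    Set (Matrix κ σ R × Matrix κ σ R) :=
  {X | FormEq (X.1ᵀ * X.2) D ∧ aᵀ * X.2 + bᵀ * X.1 = P}

/-- Exchanging the two coordinates of the `i`-th hyperbolic plane is an isometry: here for the polar
pairing, in `formEq_swapRow` for the quadratic form. -/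
lemma transpose_swapRow_mul_add [DecidableEq κ] (i : κ) (a b : Matrix κ ρ R) (u v : Matrix κ σ R) :
    (swapRow i a b)ᵀ * swapRow i v u + (swapRow i b a)ᵀ * swapRow i u v = aᵀ * v + bᵀ * u := by
  ext x y
  simp only [Matrix.add_apply, Matrix.mul_apply, ← Finset.sum_add_distrib]
  refine Finset.sum_congr rfl fun z _ => ?_
  by_cases h : z = i <;> simp [swapRow, h, add_comm]

lemma formEq_swapRow [DecidableEq κ] (i : κ) (a b : Matrix κ ρ R) :
    FormEq ((swapRow i a b)ᵀ * swapRow i b a) (aᵀ * b) := by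
  rw [formEq_iff]
  simp only [Matrix.mul_apply, ← Finset.sum_add_distrib]
  refine ⟨fun x => Finset.sum_congr rfl fun z _ => ?_,
    fun x y _ => Finset.sum_congr rfl fun z _ => ?_⟩
  · by_cases h : z = i <;> simp [swapRow, h, mul_comm]
  · by_cases h : z = i
    · simp only [swapRow, transpose_apply, of_apply, h, if_true]; ring
    · simp [swapRow, h]

lemma hasLeftInverse_swapRow [DecidableEq κ] [DecidableEq ρ] (i : κ) {a b : Matrix κ ρ R}
    (h : HasLeftInverse (fromRows a b)) :
    HasLeftInverse (fromRows (swapRow i a b) (swapRow i b a)) := by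
  obtain ⟨Z, hZ⟩ := h
  rw [← fromCols_toCols Z, fromCols_mul_fromRows] at hZ
  refine ⟨fromCols (swapRow i Z.toCols₁ᵀ Z.toCols₂ᵀ)ᵀ (swapRow i Z.toCols₂ᵀ Z.toCols₁ᵀ)ᵀ, ?_⟩
  rw [fromCols_mul_fromRows, transpose_swapRow_mul_add]
  simpa [add_comm] using hZ

lemma card_fiberSet_swapRow [DecidableEq κ] (i : κ) (a b : Matrix κ ρ R) (D : Matrix σ σ R)
    (P : Matrix ρ σ R) :
    Nat.card (fiberSet (swapRow i a b) (swapRow i b a) D P) = Nat.card (fiberSet a b D P) := by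
  let e : Matrix κ σ R × Matrix κ σ R ≃ Matrix κ σ R × Matrix κ σ R :=
    { toFun := fun X => (swapRow i X.1 X.2, swapRow i X.2 X.1)
      invFun := fun X => (swapRow i X.1 X.2, swapRow i X.2 X.1)
      left_inv := fun X => Prod.ext (swapRow_swapRow i _ _) (swapRow_swapRow i _ _)
      right_inv := fun X => Prod.ext (swapRow_swapRow i _ _) (swapRow_swapRow i _ _) }
  refine (Nat.card_congr (e.subtypeEquiv fun X => ?_)).symm
  change _ ↔ FormEq ((swapRow i X.1 X.2)ᵀ * swapRow i X.2 X.1) D ∧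
    (swapRow i a b)ᵀ * swapRow i X.2 X.1 + (swapRow i b a)ᵀ * swapRow i X.1 X.2 = P
  rw [formEq_iff_of_formEq_left (formEq_swapRow i X.1 X.2), transpose_swapRow_mul_add]
  rfl

variable [Fintype lam] [Fintype ρ]

/-- The analogue of `modifiedSet` over a commutative ring. -/
def shiftedSet (lam : Type*) [Fintype lam] (D : Matrix σ σ R) (P : Matrix ρ σ R)
    (C : Matrix ρ ρ R) : Set ((Matrix lam σ R × Matrix lam σ R) × Matrix ρ σ R) :=
  {Y | FormEq (Y.1.1ᵀ * Y.1.2) (D + (Y.2ᵀ * P + Y.2ᵀ * C * Y.2))}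

/-- The fibre over a system of vectors whose first components extend to a basis `fromCols a Y`. -/
lemma card_fiberSet_of_basis [DecidableEq κ] [DecidableEq ρ] [DecidableEq lam]
    {a b : Matrix κ ρ R} {C : Matrix ρ ρ R} (hC : FormEq (aᵀ * b) C) {Y : Matrix κ lam R}
    {Z : Matrix (ρ ⊕ lam) κ R} (h1 : fromCols a Y * Z = 1) (h2 : Z * fromCols a Y = 1)
    (D : Matrix σ σ R) (P : Matrix ρ σ R) :
    Nat.card (fiberSet a b D P) = Nat.card (shiftedSet lam D P C) := by
  have h3 : a * Z.toRows₁ + Y * Z.toRows₂ = 1 := by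
    rw [← h1, ← fromCols_mul_fromRows, fromRows_toRows]
  have h4 : fromBlocks (Z.toRows₁ * a) (Z.toRows₁ * Y) (Z.toRows₂ * a) (Z.toRows₂ * Y) =
      fromBlocks 1 0 0 1 := by
    rw [fromBlocks_one, ← h2, ← fromRows_mul_fromCols, fromRows_toRows]
  obtain ⟨h5, h6, h7, h8⟩ := Matrix.fromBlocks_inj.mp h4
  set z₁ := Z.toRows₁
  set z₂ := Z.toRows₂
  have h3' : z₁ᵀ * aᵀ + z₂ᵀ * Yᵀ = 1 := by
    rw [← transpose_mul, ← transpose_mul, ← transpose_add, h3, transpose_one]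
  have h5' : aᵀ * z₁ᵀ = 1 := by rw [← transpose_mul, h5, transpose_one]
  have h6' : Yᵀ * z₁ᵀ = 0 := by rw [← transpose_mul, h6, transpose_zero]
  have h7' : aᵀ * z₂ᵀ = 0 := by rw [← transpose_mul, h7, transpose_zero]
  have h8' : Yᵀ * z₂ᵀ = 1 := by rw [← transpose_mul, h8, transpose_one]
  -- a vector is `(u, v) = (a u₁ + Y u₂, z₁ᵀ v₁ + z₂ᵀ v₂)`, and `v₁ + bᵀ u = P`
  let F : (Matrix lam σ R × Matrix lam σ R) × Matrix ρ σ R → Matrix κ σ R × Matrix κ σ R :=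
    fun W => (Y * W.1.1 - a * W.2, z₁ᵀ * (P - bᵀ * (Y * W.1.1 - a * W.2)) +
      z₂ᵀ * (W.1.2 - Yᵀ * b * W.2))
  let G : Matrix κ σ R × Matrix κ σ R → (Matrix lam σ R × Matrix lam σ R) × Matrix ρ σ R :=
    fun X => ((z₂ * X.1, Yᵀ * X.2 - Yᵀ * b * (z₁ * X.1)), - (z₁ * X.1))
  have hGF : ∀ W, G (F W) = W := by
    rintro ⟨⟨u, v⟩, x⟩
    have e1 : z₁ * (Y * u - a * x) = -x := by
      simp only [Matrix.mul_sub, ← Matrix.mul_assoc, h5, h6]; simp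
    have e2 : z₂ * (Y * u - a * x) = u := by
      simp only [Matrix.mul_sub, ← Matrix.mul_assoc, h7, h8]; simp
    have e3 : Yᵀ * (z₁ᵀ * (P - bᵀ * (Y * u - a * x)) + z₂ᵀ * (v - Yᵀ * b * x)) =
        v - Yᵀ * b * x := by
      rw [Matrix.mul_add, ← Matrix.mul_assoc, ← Matrix.mul_assoc, h6', h8']; simp
    simp only [F, G, e1, e2, e3]
    simp
  have hFP : ∀ W, aᵀ * (F W).2 + bᵀ * (F W).1 = P := by
    rintro ⟨⟨u, v⟩, x⟩
    simp only [F]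
    rw [Matrix.mul_add, ← Matrix.mul_assoc, ← Matrix.mul_assoc, h5', h7']
    simp
  have hFG : ∀ X, aᵀ * X.2 + bᵀ * X.1 = P → F (G X) = X := by
    rintro ⟨u, v⟩ h
    have e1 : Y * (z₂ * u) - a * -(z₁ * u) = u := by
      rw [Matrix.mul_neg, sub_neg_eq_add, ← Matrix.mul_assoc, ← Matrix.mul_assoc, ← Matrix.add_mul,
        add_comm, h3, Matrix.one_mul]
    have e2 : P - bᵀ * u = aᵀ * v := by rw [← h]; simp
    have e3 : Yᵀ * v - Yᵀ * b * (z₁ * u) - Yᵀ * b * -(z₁ * u) = Yᵀ * v := by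
      rw [Matrix.mul_neg]; abel
    have e4 : z₁ᵀ * (aᵀ * v) + z₂ᵀ * (Yᵀ * v) = v := by
      rw [← Matrix.mul_assoc, ← Matrix.mul_assoc, ← Matrix.add_mul, h3', Matrix.one_mul]
    simp only [F, G, e1, e2, e3, e4]
  have hform : ∀ W, FormEq ((F W).1ᵀ * (F W).2)
      (W.1.1ᵀ * W.1.2 - (W.2ᵀ * P + W.2ᵀ * C * W.2)) := by
    rintro ⟨⟨u, v⟩, x⟩
    have e1 : (Y * u - a * x)ᵀ * z₁ᵀ = -xᵀ := by
      rw [transpose_sub, transpose_mul, transpose_mul, Matrix.sub_mul, Matrix.mul_assoc,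
        Matrix.mul_assoc, h5', h6']; simp
    have e2 : (Y * u - a * x)ᵀ * z₂ᵀ = uᵀ := by
      rw [transpose_sub, transpose_mul, transpose_mul, Matrix.sub_mul, Matrix.mul_assoc,
        Matrix.mul_assoc, h7', h8']; simp
    -- The shift by `Yᵀ * b * x` in `F` makes the cross term appear minus its own transpose, hence
    -- alternating. The coefficient `-x` of `a` gives the signs required by `shiftedSet`.
    have e3 : (F ((u, v), x)).1ᵀ * (F ((u, v), x)).2 =
        (uᵀ * v - xᵀ * P) + ((xᵀ * bᵀ * Y * u - (xᵀ * bᵀ * Y * u)ᵀ) - xᵀ * (aᵀ * b)ᵀ * x) := by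
      simp only [F]
      rw [Matrix.mul_add, ← Matrix.mul_assoc, ← Matrix.mul_assoc, e1, e2]
      simp only [Matrix.mul_sub, transpose_mul, transpose_transpose, Matrix.mul_assoc,
        Matrix.neg_mul]
      abel
    rw [e3]
    have e4 : FormEq (xᵀ * C * x) (xᵀ * (aᵀ * b)ᵀ * x) :=
      (((FormEq.transpose_self _).trans hC).congr_act x).symm
    obtain ⟨L, hL⟩ := e4
    dsimp only
    rw [hL]
    exact ⟨xᵀ * bᵀ * Y * u + L, by rw [transpose_add]; abel⟩
  have hmem : ∀ W, FormEq ((F W).1ᵀ * (F W).2) D ↔ W ∈ shiftedSet lam D P C := by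
    intro W
    rw [formEq_iff_of_formEq_left (hform W), shiftedSet, Set.mem_ofPred_eq,
      ← formEq_add_right (E := W.2ᵀ * P + W.2ᵀ * C * W.2), sub_add_cancel]
  refine Nat.card_congr
    { toFun := fun X => ⟨G X, (hmem _).mp ?_⟩
      invFun := fun W => ⟨F W, (hmem W).mpr W.2, hFP W⟩
      left_inv := fun X => Subtype.ext (hFG X X.2.2)
      right_inv := fun W => Subtype.ext (hGF W) }
  rw [hFG X X.2.2]
  exact X.2.1

/-- Over a field, for a totally isotropic system of linearly independent vectors, exchanging
suitable rows makes the kernel of the first component smaller. -/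
lemma exists_swapRow_ker_lt {K : Type*} [Field K] [DecidableEq κ] [DecidableEq ρ]
    {a b : Matrix κ ρ K} (h : HasLeftInverse (fromRows a b)) (h0 : aᵀ * b + bᵀ * a = 0)
    (hker : a.mulVecLin.ker ≠ ⊥) :
    ∃ i, (swapRow i a b).mulVecLin.ker < a.mulVecLin.ker := by
  obtain ⟨v, hv, hv0⟩ := (Submodule.ne_bot_iff _).mp hker
  rw [LinearMap.mem_ker, mulVecLin_apply] at hv
  obtain ⟨Z, hZ⟩ := h
  rw [← fromCols_toCols Z, fromCols_mul_fromRows] at hZ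
  have hbv : b *ᵥ v ≠ 0 := by
    intro hb
    apply hv0
    rw [← one_mulVec v, ← hZ, add_mulVec, ← mulVec_mulVec, ← mulVec_mulVec, hv, hb]
    simp
  obtain ⟨i, hi⟩ := Function.ne_iff.mp hbv
  refine ⟨i, lt_of_le_of_ne (fun x hx => ?_) fun heq => ?_⟩
  · rw [LinearMap.mem_ker, mulVecLin_apply] at hx ⊢
    have hx' : ∀ j, j ≠ i → (a *ᵥ x) j = 0 := fun j hj => by
      simpa [swapRow, mulVec, hj, dotProduct] using congrFun hx j
    -- Isotropy moves the pairing to `-(a v) ⬝ (b x)`, which vanishes since `v` is in the kernel of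
    -- `a`. As `a x` lives only in coordinate `i`, where `b v` is nonzero, it follows that `a x =
    -- 0`.
    have key : (b *ᵥ v) ⬝ᵥ (a *ᵥ x) = 0 := by
      have := congrArg (fun M => v ⬝ᵥ (M *ᵥ x)) h0
      simp only [add_mulVec, ← mulVec_mulVec, dotProduct_add, dotProduct_mulVec v,
        vecMul_transpose, hv] at this
      simpa using this
    rw [dotProduct, Finset.sum_eq_single i (fun j _ hj => by rw [hx' j hj, mul_zero])
      (by simp)] at key
    funext j
    by_cases hj : j = i
    · subst hj
      exact (mul_eq_zero.mp key).resolve_left hi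
    · exact hx' j hj
  · have : v ∈ (swapRow i a b).mulVecLin.ker := by
      rw [heq, LinearMap.mem_ker, mulVecLin_apply, hv]
    rw [LinearMap.mem_ker, mulVecLin_apply] at this
    exact hi (by simpa [swapRow, mulVec, dotProduct] using congrFun this i)

/-- Induction on the dimension of the kernel of `a` over the residue field. If it is zero, `a` is
primitive and `card_fiberSet_of_basis` applies. Otherwise a row exchange shrinks the kernel without
changing the fibre count, the form of `(a, b)` or its primitivity. -/
theorem card_fiberSet [IsLocalRing R] [DecidableEq κ] [DecidableEq ρ] {a b : Matrix κ ρ R}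
    (h : HasLeftInverse (fromRows a b)) {C : Matrix ρ ρ R} (hC : FormEq (aᵀ * b) C)
    (hC0 : ∀ i j, C i j ∈ maximalIdeal R) (D : Matrix σ σ R) (P : Matrix ρ σ R) :
    Nat.card (fiberSet a b D P) =
      Nat.card (shiftedSet (Fin (Fintype.card κ - Fintype.card ρ)) D P C) := by
  induction hn : Module.finrank (ResidueField R) (a.map (residue R)).mulVecLin.ker using
    Nat.strong_induction_on generalizing a b with
  | _ n ih =>
    subst hn
    by_cases hker : (a.map (residue R)).mulVecLin.ker = ⊥
    · have ha : HasLeftInverse a :=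
        (hasLeftInverse_map_iff _ residue_surjective).mp (hasLeftInverse_of_ker_eq_bot hker)
      obtain ⟨Y, Z, h1, h2⟩ := isPrimitive_iff_hasLeftInverse.mpr ha
      exact card_fiberSet_of_basis hC h1 h2 D P
    · have h' : HasLeftInverse (fromRows (a.map (residue R)) (b.map (residue R))) := by
        convert h.map (residue R)
        ext (i | i) j <;> rfl
      -- Since `C` vanishes in the residue field, `aᵀ * b` is alternating there, and an alternating
      -- matrix plus its transpose is zero.
      have h0 : (a.map (residue R))ᵀ * b.map (residue R) +
          (b.map (residue R))ᵀ * a.map (residue R) = 0 := by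
        have hCr : C.map (residue R) = 0 := by
          ext i j
          exact (residue_eq_zero_iff _).mpr (hC0 i j)
        obtain ⟨L, hL⟩ := hC.map (residue R)
        rw [hCr, zero_add, Matrix.map_mul, transpose_map] at hL
        have hL' := congrArg transpose hL
        rw [transpose_mul, transpose_transpose, transpose_sub, transpose_transpose] at hL'
        rw [hL, hL']
        abel
      obtain ⟨i, hi⟩ := exists_swapRow_ker_lt h' h0 hker
      rw [← swapRow_map] at hi
      rw [← card_fiberSet_swapRow i]
      exact ih _ (Submodule.finrank_lt_finrank_of_lt hi) (hasLeftInverse_swapRow i h)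
        ((formEq_swapRow i a b).trans hC) rfl

end Fiber

/-! ### Factorization of the number of solutions over a finite local ring -/

section Solutions

variable {R κ ν σ ρ : Type*} [CommRing R] [Fintype κ] [DecidableEq ρ]

/-- The systems of vectors in a hyperbolic space which represent the form `D` and whose members
listed by `c` are part of a basis. -/
def solutionSet (κ : Type*) [Fintype κ] (D : Matrix ν ν R) (c : ρ → ν) :
    Set (Matrix κ ν R × Matrix κ ν R) :=
  {X | FormEq (X.1ᵀ * X.2) D ∧
    HasLeftInverse (fromRows (X.1.submatrix id c) (X.2.submatrix id c))}

/-- Solutions fibre over their last block of columns. The base is the set of primitive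
representations of `C`, and all fibres have the same size by `card_fiberSet`. -/
theorem card_solutionSet_fromBlocks [IsLocalRing R] [Finite R] [Finite σ] [Fintype ρ]
    [DecidableEq κ] (D : Matrix σ σ R) (P : Matrix ρ σ R) {C : Matrix ρ ρ R}
    (hC0 : ∀ i j, C i j ∈ maximalIdeal R) :
    Nat.card (solutionSet κ (fromBlocks D 0 P C) (Sum.inr : ρ → σ ⊕ ρ)) =
      Nat.card (solutionSet κ C (id : ρ → ρ)) *
        Nat.card (shiftedSet (Fin (Fintype.card κ - Fintype.card ρ)) D P C) := by
  have key : ∀ X : Matrix κ (σ ⊕ ρ) R × Matrix κ (σ ⊕ ρ) R,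
      X ∈ solutionSet κ (fromBlocks D 0 P C) (Sum.inr : ρ → σ ⊕ ρ) ↔
      (X.1.toCols₂, X.2.toCols₂) ∈ solutionSet κ C (id : ρ → ρ) ∧
        (X.1.toCols₁, X.2.toCols₁) ∈ fiberSet X.1.toCols₂ X.2.toCols₂ D P := by
    rintro ⟨a, b⟩
    have : aᵀ * b = fromBlocks (a.toCols₁ᵀ * b.toCols₁) (a.toCols₁ᵀ * b.toCols₂)
        (a.toCols₂ᵀ * b.toCols₁) (a.toCols₂ᵀ * b.toCols₂) := by
      rw [← fromRows_mul_fromCols, ← transpose_fromCols, fromCols_toCols, fromCols_toCols]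
    simp only [solutionSet, fiberSet, Set.mem_ofPred_eq, this, formEq_fromBlocks, transpose_mul,
      transpose_transpose, transpose_zero, add_zero]
    exact ⟨fun h => ⟨⟨h.1.2.1, h.2⟩, h.1.1, h.1.2.2⟩, fun h => ⟨⟨h.2.1, h.1.1, h.2.2⟩, h.1.2⟩⟩
  let e : solutionSet κ (fromBlocks D 0 P C) (Sum.inr : ρ → σ ⊕ ρ) ≃
      Σ X : solutionSet κ C (id : ρ → ρ), fiberSet X.1.1 X.1.2 D P :=
    { toFun := fun X => ⟨⟨_, ((key X).mp X.2).1⟩, ⟨_, ((key X).mp X.2).2⟩⟩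
      invFun := fun Y => ⟨(fromCols Y.2.1.1 Y.1.1.1, fromCols Y.2.1.2 Y.1.1.2), by
        rw [key]
        simp⟩
      left_inv := fun X => by simp
      right_inv := fun Y => by simp }
  have : Fintype (solutionSet κ C (id : ρ → ρ)) := Fintype.ofFinite _
  have hf : ∀ X : solutionSet κ C (id : ρ → ρ), Nat.card (fiberSet X.1.1 X.1.2 D P) =
      Nat.card (shiftedSet (Fin (Fintype.card κ - Fintype.card ρ)) D P C) :=
    fun X => card_fiberSet X.2.2 X.2.1 hC0 D P
  rw [Nat.card_congr e, Nat.card_sigma, Finset.sum_congr rfl fun X _ => hf X]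
  simp

lemma solutionSet_nonempty [Fintype ρ] [DecidableEq κ] (ι : ρ ↪ κ) (C : Matrix ρ ρ R) :
    (solutionSet κ C (id : ρ → ρ)).Nonempty := by
  -- A coordinate inclusion satisfies `aᵀ * a = 1`, so `(a, a * C)` represents `C`, and `a` alone
  -- ensures primitivity.
  let a : Matrix κ ρ R := (1 : Matrix κ κ R).submatrix id ι
  have ha : aᵀ * a = 1 := by
    ext i j
    simp [a, Matrix.mul_apply, Matrix.one_apply, ι.injective.eq_iff, eq_comm]
  refine ⟨(a, a * C), ?_, fromCols aᵀ 0, ?_⟩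
  · rw [← Matrix.mul_assoc, ha, Matrix.one_mul]
    exact .refl C
  · simp [fromCols_mul_fromRows, ha]

end Solutions

/-! ### Coefficients of a quadratic form, indexed by unordered pairs -/

section QuadCoeff

variable {R R' ν : Type*} [CommRing R] [CommRing R']

open Classical in
/-- The coefficients of the quadratic form defined by a square matrix. -/
def quadCoeff (D : Matrix ν ν R) : Sym2 ν → R :=
  Sym2.lift ⟨fun i j => if i = j then D i i else D i j + D j i, fun i j => by
    by_cases h : i = j
    · simp [h]
    · simp [h, Ne.symm h, add_comm]⟩

lemma quadCoeff_diag (D : Matrix ν ν R) (i : ν) : quadCoeff D s(i, i) = D i i := by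
  simp [quadCoeff]

lemma quadCoeff_of_ne (D : Matrix ν ν R) {i j : ν} (h : i ≠ j) :
    quadCoeff D s(i, j) = D i j + D j i := by
  simp [quadCoeff, h]

lemma sym2_forall_iff {p : Sym2 ν → Prop} :
    (∀ z, p z) ↔ (∀ i, p s(i, i)) ∧ ∀ i j, i ≠ j → p s(i, j) := by
  refine ⟨fun h => ⟨fun i => h _, fun i j _ => h _⟩, fun h z => ?_⟩
  induction z with | _ i j
  by_cases hij : i = j
  · exact hij ▸ h.1 i
  · exact h.2 i j hij

lemma formEq_iff_quadCoeff {D D' : Matrix ν ν R} :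
    FormEq D D' ↔ quadCoeff D = quadCoeff D' := by
  rw [funext_iff, sym2_forall_iff, formEq_iff]
  refine and_congr (by simp [quadCoeff_diag]) (forall₃_congr fun i j h => ?_)
  rw [quadCoeff_of_ne _ h, quadCoeff_of_ne _ h]

lemma quadCoeff_add (D D' : Matrix ν ν R) : quadCoeff (D + D') = quadCoeff D + quadCoeff D' := by
  rw [funext_iff, sym2_forall_iff]
  refine ⟨fun i => by simp [quadCoeff_diag], fun i j h => ?_⟩
  simp only [Pi.add_apply, quadCoeff_of_ne _ h, Matrix.add_apply]
  ring

lemma quadCoeff_sub (D D' : Matrix ν ν R) : quadCoeff (D - D') = quadCoeff D - quadCoeff D' := by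
  rw [eq_sub_iff_add_eq, ← quadCoeff_add, sub_add_cancel]

lemma quadCoeff_map (D : Matrix ν ν R) (f : R →+* R') (z : Sym2 ν) :
    quadCoeff (D.map f) z = f (quadCoeff D z) := by
  revert z
  rw [sym2_forall_iff]
  refine ⟨fun i => by simp [quadCoeff_diag], fun i j h => ?_⟩
  simp [quadCoeff_of_ne _ h]

lemma exists_quadCoeff_eq (I : Set R) (h0 : 0 ∈ I) (w : Sym2 ν → R) (hw : ∀ z, w z ∈ I) :
    ∃ W : Matrix ν ν R, (∀ i j, W i j ∈ I) ∧ quadCoeff W = w := by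
  classical
  let : LinearOrder ν := IsWellOrder.linearOrder WellOrderingRel
  refine ⟨of fun i j => if i ≤ j then w s(i, j) else 0, fun i j => ?_, ?_⟩
  · rw [of_apply]
    split_ifs
    exacts [hw _, h0]
  · rw [funext_iff, sym2_forall_iff]
    refine ⟨fun i => by simp [quadCoeff_diag], fun i j h => ?_⟩
    rw [quadCoeff_of_ne _ h, of_apply, of_apply]
    rcases h.lt_or_gt with h | h
    · simp [h.le, h.not_ge]
    · simp [h.le, h.not_ge, Sym2.eq_swap]

end QuadCoeff

/-! ### Counting through fibres of constant size -/

section Counting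

lemma card_eq_mul_of_card_fiber {α β : Type*} [Finite α] [Finite β] (f : α → β) (n : ℕ)
    (h : ∀ b, Nat.card {a // f a = b} = n) : Nat.card α = Nat.card β * n := by
  have : Fintype β := Fintype.ofFinite _
  rw [← Nat.card_congr (Equiv.sigmaFiberEquiv f), Nat.card_sigma, Finset.sum_congr rfl fun b _ =>
    h b]
  simp

lemma card_preimage_mul {A B : Type*} [AddGroup A] [AddGroup B] [Finite A] [Finite B]
    (f : A →+ B) (hf : Function.Surjective f) (C : Set B) :
    Nat.card (f ⁻¹' C) * Nat.card B = Nat.card C * Nat.card A := by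
  have hfib : ∀ b, Nat.card {a // f a = b} = Nat.card f.ker := fun b => by
    obtain ⟨a₀, rfl⟩ := hf b
    refine Nat.card_congr ((Equiv.addRight (-a₀)).subtypeEquiv fun a => ?_)
    simp [AddMonoidHom.mem_ker, add_neg_eq_zero]
  have h1 := card_eq_mul_of_card_fiber f _ hfib
  have h2 : Nat.card (f ⁻¹' C) = Nat.card C * Nat.card f.ker := by
    refine card_eq_mul_of_card_fiber (fun a : f ⁻¹' C => (⟨f a, a.2⟩ : C)) _ fun b => ?_
    rw [← hfib b]
    exact Nat.card_congr
      { toFun := fun a => ⟨a.1.1, congrArg Subtype.val a.2⟩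
        invFun := fun a => ⟨⟨a.1, by rw [Set.mem_preimage, a.2]; exact b.2⟩, Subtype.ext a.2⟩
        left_inv := fun a => rfl
        right_inv := fun a => rfl }
  rw [h1, h2]
  ring

end Counting

/-! ### Comparing solution counts along a surjection of finite rings -/

section Lifting

lemma fromRows_submatrix_map {R S κ ν ρ : Type*} (f : R → S) (a b : Matrix κ ν R) (c : ρ → ν) :
    fromRows ((a.map f).submatrix id c) ((b.map f).submatrix id c) =
      (fromRows (a.submatrix id c) (b.submatrix id c)).map f := by
  ext (i | i) j <;> rfl

variable {R R' κ ν ρ : Type*} [CommRing R] [CommRing R'] [Fintype κ] [DecidableEq ρ]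

lemma solutionSet_congr {D D' : Matrix ν ν R} (h : FormEq D D') (c : ρ → ν) :
    solutionSet κ D c = solutionSet κ D' c := by
  ext X
  exact and_congr_left fun _ => formEq_iff_of_formEq_right h

/-- Counting solutions modulo an ideal `I` and modulo a smaller one, when the number of solutions
for all forms congruent to `D` modulo `I` is the same. -/
lemma card_solutionSet_map [Finite R] [Fintype ν] [Fintype ρ] [IsLocalRing R] [Nontrivial R']
    (f : R →+* R') (hf : Function.Surjective f) (D : Matrix ν ν R) (c : ρ → ν)
    (h : ∀ W : Matrix ν ν R, (∀ i j, W i j ∈ RingHom.ker f) →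
      Nat.card (solutionSet κ (D + W) c) = Nat.card (solutionSet κ D c)) :
    Nat.card (solutionSet κ (D.map f) c) * Nat.card (Matrix κ ν R × Matrix κ ν R) =
      Nat.card (Matrix κ ν R' × Matrix κ ν R') *
        (Nat.card (RingHom.ker f) ^ (Fintype.card ν * (Fintype.card ν + 1) / 2) *
          Nat.card (solutionSet κ D c)) := by
  have hR' : Finite R' := Finite.of_surjective f hf
  have hloc : IsLocalHom f := .of_surjective f hf
  let F : Matrix κ ν R × Matrix κ ν R →+ Matrix κ ν R' × Matrix κ ν R' :=
    f.toAddMonoidHom.mapMatrix.prodMap f.toAddMonoidHom.mapMatrix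
  have hF : Function.Surjective F := by
    rintro ⟨a, b⟩
    refine ⟨(a.map (Function.surjInv hf), b.map (Function.surjInv hf)), Prod.ext ?_ ?_⟩ <;>
    · ext i j
      exact Function.surjInv_eq hf _
  have hmem : ∀ X, F X ∈ solutionSet κ (D.map f) c ↔
      (∀ z, quadCoeff (X.1ᵀ * X.2 - D) z ∈ RingHom.ker f) ∧
      HasLeftInverse (fromRows (X.1.submatrix id c) (X.2.submatrix id c)) := by
    rintro ⟨a, b⟩
    refine and_congr ?_ ?_
    · change FormEq ((a.map f)ᵀ * b.map f) (D.map f) ↔ _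
      rw [← transpose_map, ← Matrix.map_mul, formEq_iff_quadCoeff, funext_iff]
      refine forall_congr' fun z => ?_
      rw [quadCoeff_map, quadCoeff_map, quadCoeff_sub, Pi.sub_apply, RingHom.mem_ker, map_sub,
        sub_eq_zero]
    · change HasLeftInverse (fromRows ((a.map f).submatrix id c) ((b.map f).submatrix id c)) ↔ _
      rw [fromRows_submatrix_map, hasLeftInverse_map_iff f hf]
  -- Solutions downstairs, pulled back, are sorted by the error in their form, a tuple of
  -- coefficients in the kernel. The fibre over an error `W` is the solution set of `D + W`.
  let g : F ⁻¹' solutionSet κ (D.map f) c → (Sym2 ν → RingHom.ker f) :=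
    fun X z => ⟨quadCoeff (X.1.1ᵀ * X.1.2 - D) z, ((hmem X.1).mp X.2).1 z⟩
  have hg : ∀ w, Nat.card {X // g X = w} = Nat.card (solutionSet κ D c) := by
    intro w
    obtain ⟨W, hW, hW'⟩ := exists_quadCoeff_eq (RingHom.ker f : Set R) (zero_mem _)
      (fun z => (w z : R)) fun z => (w z).2
    have hgw : ∀ X, g X = w ↔ FormEq (X.1.1ᵀ * X.1.2) (D + W) := by
      intro X
      rw [formEq_iff_quadCoeff, quadCoeff_add, hW', ← sub_eq_iff_eq_add', ← quadCoeff_sub,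
        funext_iff, funext_iff]
      exact forall_congr' fun z => Subtype.ext_iff
    rw [← h W hW]
    refine Nat.card_congr
      { toFun := fun X => ⟨X.1.1, (hgw _).mp X.2, ((hmem _).mp X.1.2).2⟩
        invFun := fun X => ⟨⟨X.1, (hmem _).mpr ⟨fun z => ?_, X.2.2⟩⟩, (hgw _).mpr X.2.1⟩
        left_inv := fun X => rfl
        right_inv := fun X => rfl }
    have := formEq_iff_quadCoeff.mp X.2.1
    rw [quadCoeff_add, hW', ← sub_eq_iff_eq_add', ← quadCoeff_sub] at this
    rw [this]
    exact (w z).2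
  have h1 := card_preimage_mul F hF (solutionSet κ (D.map f) c)
  have h2 := card_eq_mul_of_card_fiber g _ hg
  -- There are `n(n+1)/2` unordered pairs, which is the source of the normalizing exponent.
  have h3 : Nat.card (Sym2 ν → RingHom.ker f) =
      Nat.card (RingHom.ker f) ^ (Fintype.card ν * (Fintype.card ν + 1) / 2) := by
    rw [Nat.card_fun, Nat.card_eq_fintype_card (α := Sym2 ν), Sym2.card, Nat.choose_two_right,
      Nat.add_sub_cancel, mul_comm (Fintype.card ν)]
  rw [← h1, h2, h3]
  ring

end Lifting

/-! ### Stability of the counts under small changes of the form -/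

section Stability

variable {R κ ν ρ : Type*} [CommRing R] [Fintype κ] [DecidableEq ρ]

lemma mul_eq_zero_of_entries {κ μ ν : Type*} [Fintype μ] {I J : Set R}
    (h : ∀ x ∈ I, ∀ y ∈ J, x * y = 0) {A : Matrix κ μ R} {B : Matrix μ ν R}
    (hA : ∀ i j, A i j ∈ I) (hB : ∀ i j, B i j ∈ J) : A * B = 0 := by
  ext i j
  exact Finset.sum_eq_zero fun l _ => h _ (hA i l) _ (hB l j)

lemma mul_mem_of_entries {κ μ ν : Type*} [Fintype μ] (I : Ideal R) (A : Matrix κ μ R)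
    {B : Matrix μ ν R} (hB : ∀ i j, B i j ∈ I) (i : κ) (j : ν) : (A * B) i j ∈ I :=
  Ideal.sum_mem _ fun l _ => I.mul_mem_left _ (hB l j)

/-- If `Z` is a left inverse of `X` modulo the maximal ideal, moving `X` by the two blocks of `Z`,
interchanged and multiplied by `W`, changes its form by exactly `W`. This correction is injective
because `Z` is chosen from the residue of `X`, which the correction does not alter. -/
lemma card_solutionSet_le_add [IsLocalRing R] [Finite R] [Fintype ρ] (I : Ideal R)
    (hI : I ≤ maximalIdeal R) (hI' : ∀ x ∈ I, ∀ y ∈ maximalIdeal R, x * y = 0)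
    (D W : Matrix ρ ρ R) (hW : ∀ i j, W i j ∈ I) :
    Nat.card (solutionSet κ D (id : ρ → ρ)) ≤ Nat.card (solutionSet κ (D + W) (id : ρ → ρ)) := by
  -- The value 0 for systems that are not primitive only makes the correction total, and is never
  -- used on solutions.
  have hZ : ∀ ξ : Matrix (κ ⊕ κ) ρ (ResidueField R), ∃ Z : Matrix ρ (κ ⊕ κ) R,
      HasLeftInverse ξ → Z.map (residue R) * ξ = 1 := by
    intro ξ
    by_cases h : HasLeftInverse ξ
    · obtain ⟨Z, hZ⟩ := h
      refine ⟨Z.map (Function.surjInv residue_surjective), fun _ => ?_⟩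
      rw [← hZ]
      congr 1
      ext i j
      exact Function.surjInv_eq residue_surjective _
    · exact ⟨0, fun h' => (h h').elim⟩
  choose Z hZ using hZ
  let ξ : Matrix κ ρ R × Matrix κ ρ R → Matrix (κ ⊕ κ) ρ (ResidueField R) :=
    fun X => (fromRows X.1 X.2).map (residue R)
  let F : Matrix κ ρ R × Matrix κ ρ R → Matrix κ ρ R × Matrix κ ρ R :=
    fun X => (X.1 + (Z (ξ X)).toCols₂ᵀ * W, X.2 + (Z (ξ X)).toCols₁ᵀ * W)
  have hξF : ∀ X, ξ (F X) = ξ X := by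
    intro X
    have h0 : ∀ (B : Matrix κ ρ R) i j, residue R ((B * W) i j) = 0 := fun B i j =>
      (residue_eq_zero_iff _).mpr (hI (mul_mem_of_entries I B hW i j))
    ext (i | i) j <;> simp [ξ, F, h0]
  have hinj : Function.Injective F := by
    intro X X' h
    have h' : ξ X = ξ X' := by rw [← hξF X, ← hξF X', h]
    simp only [F, h', Prod.mk.injEq, add_left_inj] at h
    exact Prod.ext h.1 h.2
  have hform : ∀ X, HasLeftInverse (fromRows X.1 X.2) →
      FormEq ((F X).1ᵀ * (F X).2) (X.1ᵀ * X.2 + W) := by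
    intro X hX
    have h1 := hZ (ξ X) (hX.map _)
    simp only [F]
    set z := Z (ξ X)
    -- `Z * X` is the identity only modulo the maximal ideal, but `W` annihilates the discrepancy.
    have h2 : (z * fromRows X.1 X.2)ᵀ * W = W := by
      rw [← sub_eq_zero]
      nth_rewrite 2 [← Matrix.one_mul W]
      rw [← Matrix.sub_mul]
      refine mul_eq_zero_of_entries (I := maximalIdeal R) (J := I)
        (fun x hx y hy => by rw [mul_comm]; exact hI' y hy x hx) (fun i j => ?_) hW
      have h3 := congrFun₂ h1 j i
      simp only [ξ] at h3
      rw [← Matrix.map_mul, Matrix.map_apply] at h3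
      rw [SetLike.mem_coe, ← residue_eq_zero_iff, Matrix.sub_apply, transpose_apply, map_sub, h3]
      by_cases hij : i = j
      · subst hij
        simp only [Matrix.one_apply_eq, map_one, sub_self]
      · simp [hij, Ne.symm hij]
    rw [← fromCols_toCols z, fromCols_mul_fromRows, transpose_add, transpose_mul, transpose_mul,
      Matrix.add_mul] at h2
    -- The second-order term lies in `I * I`, which is zero because `I` is contained in the maximal
    -- ideal.
    have h4 : Wᵀ * (z.toCols₂ * z.toCols₁ᵀ * W) = 0 :=
      mul_eq_zero_of_entries (I := I) (J := maximalIdeal R) hI' (fun i j => hW j i)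
        fun i j => hI (mul_mem_of_entries I _ hW i j)
    have h5 : (X.1 + z.toCols₂ᵀ * W)ᵀ * (X.2 + z.toCols₁ᵀ * W) =
        X.1ᵀ * X.2 + (X.1ᵀ * z.toCols₁ᵀ * W + (X.2ᵀ * z.toCols₂ᵀ * W)ᵀ) +
          Wᵀ * (z.toCols₂ * z.toCols₁ᵀ * W) := by
      simp only [transpose_add, transpose_mul, transpose_transpose, Matrix.add_mul,
        Matrix.mul_add, Matrix.mul_assoc]
      abel
    rw [h5, h4, add_zero]
    nth_rewrite 3 [← h2]
    exact (FormEq.refl _).add ((FormEq.refl _).add (FormEq.transpose_self _))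
  have hmaps : ∀ X ∈ solutionSet κ D (id : ρ → ρ), F X ∈ solutionSet κ (D + W) (id : ρ → ρ) := by
    rintro X ⟨h1, h2⟩
    rw [submatrix_id_id, submatrix_id_id] at h2
    refine ⟨(hform X h2).trans (h1.add (.refl W)), ?_⟩
    rw [submatrix_id_id, submatrix_id_id, ← hasLeftInverse_map_iff (residue R) residue_surjective]
    change HasLeftInverse (ξ (F X))
    rw [hξF]
    exact h2.map _
  exact Nat.card_le_card_of_injective (fun X => ⟨F X.1, hmaps _ X.2⟩)
    fun X X' h => Subtype.ext (hinj (congrArg Subtype.val h))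

/-- The number of primitive solutions does not change if the form changes by a form with
coefficients in an ideal annihilated by the maximal ideal. -/
lemma card_solutionSet_add [IsLocalRing R] [Finite R] [Fintype ρ] (I : Ideal R)
    (hI : I ≤ maximalIdeal R) (hI' : ∀ x ∈ I, ∀ y ∈ maximalIdeal R, x * y = 0)
    (D W : Matrix ρ ρ R) (hW : ∀ i j, W i j ∈ I) :
    Nat.card (solutionSet κ (D + W) (id : ρ → ρ)) = Nat.card (solutionSet κ D (id : ρ → ρ)) := by
  refine le_antisymm ?_ (card_solutionSet_le_add I hI hI' D W hW)
  have := card_solutionSet_le_add (κ := κ) I hI hI' (D + W) (-W) fun i j => I.neg_mem (hW i j)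
  rwa [add_neg_cancel_right] at this

/-- Right multiplication by the invertible matrix `1 + V` is a bijection of systems. Because it is
the identity modulo the maximal ideal, it preserves primitivity of any chosen columns, even though
it mixes columns. -/
lemma card_solutionSet_act [IsLocalRing R] [Fintype ν] [DecidableEq ν] [Fintype ρ]
    (D : Matrix ν ν R) (c : ρ → ν) (V : Matrix ν ν R) (hV : ∀ i j, V i j ∈ maximalIdeal R) :
    Nat.card (solutionSet κ ((1 + V)ᵀ * D * (1 + V)) c) = Nat.card (solutionSet κ D c) := by
  have hU : IsUnit (1 + V).det := by
    rw [← isUnit_map_iff (residue R), RingHom.map_det, RingHom.mapMatrix_apply]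
    convert isUnit_one
    rw [show (1 + V).map (residue R) = 1 from ?_, det_one]
    ext i j
    rw [Matrix.map_apply, Matrix.add_apply, map_add, (residue_eq_zero_iff _).mpr (hV i j),
      add_zero]
    by_cases h : i = j <;> simp [h, Matrix.one_apply]
  have h1 := Matrix.mul_nonsing_inv _ hU
  have h2 := Matrix.nonsing_inv_mul _ hU
  set U := 1 + V with hUdef
  let e : Matrix κ ν R × Matrix κ ν R ≃ Matrix κ ν R × Matrix κ ν R :=
    { toFun := fun X => (X.1 * U, X.2 * U)
      invFun := fun X => (X.1 * U⁻¹, X.2 * U⁻¹)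
      left_inv := fun X => by simp [Matrix.mul_assoc, h1]
      right_inv := fun X => by simp [Matrix.mul_assoc, h2] }
  refine (Nat.card_congr (e.subtypeEquiv fun X => and_congr ?_ ?_)).symm
  · change _ ↔ FormEq ((X.1 * U)ᵀ * (X.2 * U)) _
    have h3 : (X.1 * U)ᵀ * (X.2 * U) = Uᵀ * (X.1ᵀ * X.2) * U := by
      simp only [transpose_mul, Matrix.mul_assoc]
    rw [h3]
    refine ⟨fun h => h.congr_act U, fun h => ?_⟩
    have h4 : ∀ E : Matrix ν ν R, U⁻¹ᵀ * (Uᵀ * E * U) * U⁻¹ = E := fun E => by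
      rw [← Matrix.mul_assoc, ← Matrix.mul_assoc, ← transpose_mul, h1, transpose_one,
        Matrix.one_mul, Matrix.mul_assoc, h1, Matrix.mul_one]
    simpa only [h4] using h.congr_act U⁻¹
  · rw [← hasLeftInverse_map_iff (residue R) residue_surjective,
      ← hasLeftInverse_map_iff (residue R) residue_surjective (X := fromRows _ _)]
    refine iff_of_eq (congrArg HasLeftInverse ?_)
    have h0 : ∀ (B : Matrix κ ν R) i j, residue R ((B * V) i j) = 0 := fun B i j =>
      (residue_eq_zero_iff _).mpr (mul_mem_of_entries _ B hV i j)
    ext (i | i) j <;> simp [e, hUdef, Matrix.mul_add, h0]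

end Stability

/-! ### Absorbing a perturbation of a non-degenerate form -/

section NonDegenerate

variable {O R κ ν ρ : Type*} [CommRing O] [CommRing R] [Fintype κ] [DecidableEq ρ] [Fintype ρ]
  [Fintype ν] [DecidableEq ν] [IsLocalRing R]

/-- For a non-degenerate form, the number of solutions does not change if the form changes by a
sufficiently small form. -/
lemma card_solutionSet_add_of_det_dvd (f : O →+* R) {ϖ : O} (hϖ : f ϖ ∈ maximalIdeal R)
    {d e : ℕ} (he : 2 * d + 1 ≤ e) (hf : f ϖ ^ (e + 1) = 0) (D : Matrix ν ν O)
    (hD : (D + Dᵀ).det ∣ ϖ ^ d) (c : ρ → ν) (W : Matrix ν ν O) :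
    Nat.card (solutionSet κ (D.map f + (ϖ ^ e • W).map f) c) =
      Nat.card (solutionSet κ (D.map f) c) := by
  obtain ⟨x, hx⟩ := hD
  -- The adjugate solves the linearized equation `(D + Dᵀ) * V = ϖ ^ e • W` at the cost of `ϖ ^ d`,
  -- so `V` is still divisible by `ϖ ^ (e - d)`.
  let V₀ : Matrix ν ν O := x • ((D + Dᵀ).adjugate * W)
  let V : Matrix ν ν O := ϖ ^ (e - d) • V₀
  have hV : (D + Dᵀ) * V = ϖ ^ e • W := by
    simp only [V, V₀, Matrix.mul_smul, ← Matrix.mul_assoc, mul_adjugate, smul_smul,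
      Matrix.smul_mul, Matrix.one_mul]
    congr 1
    rw [mul_assoc, mul_comm x, ← hx, ← pow_add]
    congr 1
    omega
  -- The quadratic term carries `ϖ ^ (2 * (e - d))`, and `2 * (e - d) ≥ e + 1` is precisely the
  -- bound on `e`.
  have hV' : (Vᵀ * D * V).map f = 0 := by
    have : f ϖ ^ (e - d) * f ϖ ^ (e - d) = 0 := by
      rw [← pow_add, show e - d + (e - d) = e + 1 + (e - d + (e - d) - (e + 1)) by omega, pow_add,
        hf, zero_mul]
    ext i j
    simp only [V, transpose_smul, Matrix.smul_mul, Matrix.mul_smul, smul_smul, Matrix.map_apply,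
      Matrix.smul_apply, smul_eq_mul, map_mul, map_pow, this, zero_mul, Matrix.zero_apply]
  -- Modulo alternating matrices `Vᵀ * D` may be replaced by its transpose `Dᵀ * V`, so the linear
  -- terms add up to `(D + Dᵀ) * V`.
  have hform : FormEq (D + ϖ ^ e • W) ((1 + V)ᵀ * D * (1 + V) - Vᵀ * D * V) := by
    rw [← hV]
    refine ⟨Dᵀ * V, ?_⟩
    simp only [transpose_add, transpose_one, transpose_mul, transpose_transpose, Matrix.add_mul,
      Matrix.mul_add, Matrix.one_mul, Matrix.mul_one]
    abel
  have hform' := hform.map f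
  rw [Matrix.map_add f f.map_add, Matrix.map_sub f f.map_sub, hV', sub_zero, Matrix.map_mul,
    Matrix.map_mul, transpose_map, Matrix.map_add f f.map_add,
    Matrix.map_one _ f.map_zero f.map_one]
    at hform'
  rw [solutionSet_congr hform']
  refine card_solutionSet_act _ c _ fun i j => ?_
  simp only [V, Matrix.map_apply, Matrix.smul_apply, smul_eq_mul, map_mul, map_pow]
  exact Ideal.mul_mem_right _ _ (Ideal.pow_mem_of_mem _ hϖ _ (by omega))

end NonDegenerate

/-! ### The finite quotients of a discrete valuation ring -/

section Level

variable {O : Type*} [CommRing O]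

/-- The quotient map `𝔬 → 𝔬 / ϖ ^ e 𝔬`. -/
abbrev levelMap (ϖ : O) (e : ℕ) : O →+* O ⧸ Ideal.span {ϖ ^ e} := Ideal.Quotient.mk _

lemma levelMap_surjective (ϖ : O) (e : ℕ) : Function.Surjective (levelMap ϖ e) :=
  Ideal.Quotient.mk_surjective

lemma levelMap_eq_zero_iff {ϖ : O} {e : ℕ} {x : O} : levelMap ϖ e x = 0 ↔ ϖ ^ e ∣ x := by
  rw [Ideal.Quotient.eq_zero_iff_mem, Ideal.mem_span_singleton]

/-- The quotient map `𝔬 / ϖ ^ (e + 1) 𝔬 → 𝔬 / ϖ ^ e 𝔬`. -/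
abbrev levelDown (ϖ : O) (e : ℕ) : O ⧸ Ideal.span {ϖ ^ (e + 1)} →+* O ⧸ Ideal.span {ϖ ^ e} :=
  Ideal.Quotient.factor (Ideal.span_singleton_le_span_singleton.mpr (pow_dvd_pow ϖ e.le_succ))

lemma levelDown_levelMap (ϖ : O) (e : ℕ) (x : O) :
    levelDown ϖ e (levelMap ϖ (e + 1) x) = levelMap ϖ e x := rfl

lemma levelDown_surjective (ϖ : O) (e : ℕ) : Function.Surjective (levelDown ϖ e) :=
  Ideal.Quotient.factor_surjective _

lemma exists_of_mem_ker_levelDown {ϖ : O} {e : ℕ} {x : O ⧸ Ideal.span {ϖ ^ (e + 1)}}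
    (hx : x ∈ RingHom.ker (levelDown ϖ e)) : ∃ y, levelMap ϖ (e + 1) (ϖ ^ e * y) = x := by
  obtain ⟨z, rfl⟩ := levelMap_surjective ϖ (e + 1) x
  rw [RingHom.mem_ker, levelDown_levelMap, levelMap_eq_zero_iff] at hx
  obtain ⟨y, rfl⟩ := hx
  exact ⟨y, rfl⟩

variable [IsDomain O] [IsDiscreteValuationRing O] {ϖ : O}

lemma levelMap_mem_maximalIdeal {e : ℕ} [IsLocalRing (O ⧸ Ideal.span {ϖ ^ e})]
    (hϖ : Irreducible ϖ) : levelMap ϖ e ϖ ∈ maximalIdeal (O ⧸ Ideal.span {ϖ ^ e}) := by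
  have := IsLocalHom.of_surjective (levelMap ϖ e) (levelMap_surjective ϖ e)
  rw [mem_maximalIdeal, mem_nonunits_iff, isUnit_map_iff]
  exact hϖ.not_isUnit

lemma isLocalRing_level (hϖ : Irreducible ϖ) {e : ℕ} (he : 1 ≤ e) :
    IsLocalRing (O ⧸ Ideal.span {ϖ ^ e}) := by
  have : Nontrivial (O ⧸ Ideal.span {ϖ ^ e}) := by
    rw [Ideal.Quotient.nontrivial_iff, Ne, Ideal.span_singleton_eq_top, isUnit_pow_iff (by omega)]
    exact hϖ.not_isUnit
  exact .of_surjective' (levelMap ϖ e) (levelMap_surjective ϖ e)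

lemma card_level (hϖ : Irreducible ϖ) (e : ℕ) :
    Nat.card (O ⧸ Ideal.span {ϖ ^ e}) = Nat.card (ResidueField O) ^ e := by
  rw [← Ideal.span_singleton_pow, ← hϖ.maximalIdeal_eq]
  exact cardQuot_pow_of_prime (P := maximalIdeal O) (IsDiscreteValuationRing.not_a_field O)

variable [Finite (ResidueField O)]

lemma finite_level (hϖ : Irreducible ϖ) (e : ℕ) : Finite (O ⧸ Ideal.span {ϖ ^ e}) := by
  refine Nat.finite_of_card_ne_zero ?_
  rw [card_level hϖ]
  exact pow_ne_zero _ Nat.card_pos.ne'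

lemma card_ker_levelDown (hϖ : Irreducible ϖ) (e : ℕ) :
    Nat.card (RingHom.ker (levelDown ϖ e)) = Nat.card (ResidueField O) := by
  have := finite_level hϖ e
  have := finite_level hϖ (e + 1)
  have h := card_preimage_mul (levelDown ϖ e).toAddMonoidHom (levelDown_surjective ϖ e) {0}
  rw [card_level hϖ, card_level hϖ, Nat.card_unique (α := ({0} : Set _)), one_mul]
    at h
  refine Nat.eq_of_mul_eq_mul_right (pow_pos Nat.card_pos e) (h.trans ?_)
  rw [pow_succ, mul_comm]

end Level

/-! ### Normalized counts and their eventual constancy -/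

section NormalizedCount

variable {O κ ν ρ : Type*} [CommRing O] [IsDomain O] [IsDiscreteValuationRing O]
  [Fintype κ] [Fintype ν] [DecidableEq ρ]

/-- The normalized number of solutions modulo `ϖ ^ e`. -/
def normCount (κ : Type*) [Fintype κ] (ϖ : O) (D : Matrix ν ν O) (c : ρ → ν) (e : ℕ) : ℝ :=
  (Nat.card (ResidueField O) : ℝ) ^ (e * (Fintype.card ν * (Fintype.card ν + 1) / 2)) *
    (Nat.card (solutionSet κ (D.map (levelMap ϖ e)) c) /
      Nat.card (Matrix κ ν (O ⧸ Ideal.span {ϖ ^ e}) × Matrix κ ν (O ⧸ Ideal.span {ϖ ^ e})))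

variable {ϖ : O} [Finite (ResidueField O)] [Fintype ρ]

lemma normCount_succ (hϖ : Irreducible ϖ) {D : Matrix ν ν O} {c : ρ → ν} {e : ℕ} (he : 1 ≤ e)
    (h : ∀ W : Matrix ν ν (O ⧸ Ideal.span {ϖ ^ (e + 1)}),
      (∀ i j, W i j ∈ RingHom.ker (levelDown ϖ e)) →
      Nat.card (solutionSet κ (D.map (levelMap ϖ (e + 1)) + W) c) =
        Nat.card (solutionSet κ (D.map (levelMap ϖ (e + 1))) c)) :
    normCount κ ϖ D c (e + 1) = normCount κ ϖ D c e := by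
  have := finite_level hϖ e
  have := finite_level hϖ (e + 1)
  have := isLocalRing_level hϖ he
  have := isLocalRing_level hϖ (e := e + 1) (by omega)
  have key := card_solutionSet_map (κ := κ) (levelDown ϖ e) (levelDown_surjective ϖ e) _ c h
  rw [card_ker_levelDown hϖ, Matrix.map_map] at key
  have key' := congrArg (Nat.cast : ℕ → ℝ) key
  push_cast only [Nat.cast_mul, Nat.cast_pow] at key'
  have h1 : (Nat.card (Matrix κ ν (O ⧸ Ideal.span {ϖ ^ e}) ×
      Matrix κ ν (O ⧸ Ideal.span {ϖ ^ e})) : ℝ) ≠ 0 := Nat.cast_ne_zero.mpr Nat.card_pos.ne'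
  have h2 : (Nat.card (Matrix κ ν (O ⧸ Ideal.span {ϖ ^ (e + 1)}) ×
      Matrix κ ν (O ⧸ Ideal.span {ϖ ^ (e + 1)})) : ℝ) ≠ 0 :=
    Nat.cast_ne_zero.mpr Nat.card_pos.ne'
  rw [normCount, normCount, add_mul, one_mul, pow_add, mul_assoc]
  congr 1
  rw [← mul_div_assoc, div_eq_div_iff h2 h1, mul_comm]
  exact key'.symm

/-- The kernel from level `e + 1` to level `e` is generated by `ϖ ^ e` and so is annihilated by the
maximal ideal. No non-degeneracy is needed when all columns are primitive. -/
lemma normCount_succ_of_primitive (hϖ : Irreducible ϖ) (D : Matrix ρ ρ O) {e : ℕ} (he : 1 ≤ e) :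
    normCount κ ϖ D (id : ρ → ρ) (e + 1) = normCount κ ϖ D (id : ρ → ρ) e := by
  refine normCount_succ hϖ he fun W hW => ?_
  have := finite_level hϖ (e + 1)
  have := isLocalRing_level hϖ he
  have := isLocalRing_level hϖ (e := e + 1) (by omega)
  have := IsLocalHom.of_surjective (levelMap ϖ (e + 1)) (levelMap_surjective ϖ (e + 1))
  refine card_solutionSet_add (RingHom.ker (levelDown ϖ e))
    (le_maximalIdeal (RingHom.ker_ne_top _)) ?_ _ _ hW
  intro x hx y hy
  obtain ⟨x, rfl⟩ := exists_of_mem_ker_levelDown hx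
  obtain ⟨y, rfl⟩ := levelMap_surjective ϖ (e + 1) y
  rw [mem_maximalIdeal, mem_nonunits_iff, isUnit_map_iff, ← mem_nonunits_iff, ← mem_maximalIdeal,
    hϖ.maximalIdeal_eq, Ideal.mem_span_singleton] at hy
  obtain ⟨z, rfl⟩ := hy
  rw [← map_mul, levelMap_eq_zero_iff]
  exact ⟨x * z, by ring⟩

lemma normCount_succ_of_det_dvd [DecidableEq ν] (hϖ : Irreducible ϖ) (D : Matrix ν ν O)
    (c : ρ → ν) {d e : ℕ} (hD : (D + Dᵀ).det ∣ ϖ ^ d) (he : 2 * d + 1 ≤ e) :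
    normCount κ ϖ D c (e + 1) = normCount κ ϖ D c e := by
  refine normCount_succ hϖ (by omega) fun W hW => ?_
  have := isLocalRing_level hϖ (e := e + 1) (by omega)
  choose W' hW' using fun i j => exists_of_mem_ker_levelDown (hW i j)
  have : W = (ϖ ^ e • of W').map (levelMap ϖ (e + 1)) := by
    ext i j
    simp [← hW']
  rw [this]
  refine card_solutionSet_add_of_det_dvd _ (levelMap_mem_maximalIdeal hϖ) he ?_ D hD c _
  rw [← map_pow, levelMap_eq_zero_iff]

lemma eq_of_forall_succ_eq {f : ℕ → ℝ} {n : ℕ} (h : ∀ e, n ≤ e → f (e + 1) = f e) {e : ℕ}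
    (he : n ≤ e) : f e = f n := by
  induction e, he using Nat.le_induction with
  | base => rfl
  | succ e he ih => rw [h e he, ih]

end NormalizedCount

/-! ### Haar volume as a proportion in a finite quotient -/

section Volume

open MeasureTheory

/-- The volume of the preimage of a subset of a finite quotient. -/
lemma vol_preimage {G H : Type*} [AddGroup G] [TopologicalSpace G] [IsTopologicalAddGroup G]
    [CompactSpace G] [AddGroup H] [Finite H] (f : G →+ H) (hf : Function.Surjective f)
    (hker : IsOpen (f.ker : Set G)) (C : Set H) :
    vol (f ⁻¹' C) = Nat.card C / Nat.card H := by
  classical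
  let _ : MeasurableSpace G := borel G
  have _ : BorelSpace G := ⟨rfl⟩
  set μ := Measure.addHaarMeasure (⊤ : TopologicalSpace.PositiveCompacts G) with hμ
  have hvol : ∀ S : Set G, vol S = μ.real S := fun _ => rfl
  have huniv : μ.real Set.univ = 1 := by
    rw [measureReal_def, hμ, ← TopologicalSpace.PositiveCompacts.coe_top,
      Measure.addHaarMeasure_self, ENNReal.toReal_one]
  have hfin : IsFiniteMeasure μ := inferInstance
  have hfib : ∀ g, f ⁻¹' {f g} = (fun x => -g + x) ⁻¹' f.ker := fun g => by
    ext x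
    simp [AddMonoidHom.mem_ker, neg_add_eq_zero, eq_comm (a := f x)]
  have hopen : ∀ h, IsOpen (f ⁻¹' {h}) := fun h => by
    obtain ⟨g, rfl⟩ := hf h
    rw [hfib]
    exact hker.preimage (continuous_const_add _)
  have hmeas : ∀ h, μ.real (f ⁻¹' {h}) = μ.real f.ker := fun h => by
    obtain ⟨g, rfl⟩ := hf h
    rw [hfib, measureReal_def, measure_preimage_add, measureReal_def]
  have hC : ∀ C : Set H, μ.real (f ⁻¹' C) = Nat.card C * μ.real f.ker := fun C => by
    have : Fintype C := Fintype.ofFinite _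
    have h1 : f ⁻¹' C = ⋃ h ∈ C.toFinset, f ⁻¹' {h} := by ext; simp
    rw [h1, measureReal_biUnion_finset
      (fun a _ b _ hab => Disjoint.preimage _ (Set.disjoint_singleton.mpr hab))
      (fun h _ => (hopen h).measurableSet), Finset.sum_congr rfl fun h _ => hmeas h]
    simp
  have h1 := hC Set.univ
  rw [Set.preimage_univ, huniv, Nat.card_univ] at h1
  have h2 : (Nat.card H : ℝ) ≠ 0 := Nat.cast_ne_zero.mpr Nat.card_pos.ne'
  rw [hvol, hC, eq_div_iff h2, mul_assoc, mul_comm (μ.real _), ← h1, mul_one]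

end Volume

/-! ### The two totally singular halves of the hyperbolic space -/

section Hyperbolic

variable {R κ ν : Type*}

/-- The components of a system of vectors in the first totally singular subspace of the
hyperbolic space. -/
def topRows (X : Matrix (Fin 2 × κ) ν R) : Matrix κ ν R := X.submatrix (Prod.mk 0) id

/-- The components of a system of vectors in the second totally singular subspace of the
hyperbolic space. -/
def botRows (X : Matrix (Fin 2 × κ) ν R) : Matrix κ ν R := X.submatrix (Prod.mk 1) id

lemma hasLeftInverse_topRows_botRows {ρ : Type*} [CommRing R] [Fintype κ] [DecidableEq ρ]
    {X : Matrix (Fin 2 × κ) ρ R} :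
    HasLeftInverse (fromRows (topRows X) (botRows X)) ↔ HasLeftInverse X := by
  have key : ∀ (Z₁ Z₂ : Matrix ρ κ R) (Z : Matrix ρ (Fin 2 × κ) R),
      (∀ i j, Z i (0, j) = Z₁ i j) → (∀ i j, Z i (1, j) = Z₂ i j) →
      fromCols Z₁ Z₂ * fromRows (topRows X) (botRows X) = Z * X := by
    intro Z₁ Z₂ Z h1 h2
    rw [fromCols_mul_fromRows]
    ext i j
    simp [Matrix.mul_apply, Fintype.sum_prod_type, h1, h2, topRows, botRows]
  constructor
  · rintro ⟨Z, hZ⟩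
    refine ⟨of fun i p => if p.1 = 0 then Z.toCols₁ i p.2 else Z.toCols₂ i p.2, ?_⟩
    rw [← hZ, ← fromCols_toCols Z]
    exact (key _ _ _ (by simp) (by simp)).symm
  · rintro ⟨Z, hZ⟩
    refine ⟨fromCols (of fun i j => Z i (0, j)) (of fun i j => Z i (1, j)), ?_⟩
    rw [← hZ]
    exact key _ _ _ (by simp) (by simp)

end Hyperbolic

variable {F : Type*} [Field F] [ValuativeRel F]

/-! ### Integral matrices over the field -/

section ToField

variable {ι κ ν : Type*}

lemma toField_eq_map (X : Matrix ι κ 𝒪[F]) : toField X = X.map 𝒪[F].subtype := rfl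

lemma toField_mul [Fintype κ] (X : Matrix ι κ 𝒪[F]) (Y : Matrix κ ν 𝒪[F]) :
    toField (X * Y) = toField X * toField Y :=
  Matrix.map_mul (f := 𝒪[F].subtype)

lemma toField_add (X Y : Matrix ι κ 𝒪[F]) : toField (X + Y) = toField X + toField Y :=
  Matrix.map_add 𝒪[F].subtype (map_add _) _ _

lemma toField_transpose (X : Matrix ι κ 𝒪[F]) : toField Xᵀ = (toField X)ᵀ := rfl

lemma toField_fromRows_one {ρ : Type*} [DecidableEq ν] (x : Matrix ρ ν 𝒪[F]) :
    toField (fromRows (1 : Matrix ν ν 𝒪[F]) x) = fromRows 1 (toField x) := by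
  ext (i | i) j
  · by_cases h : i = j <;> simp [toField, h]
  · rfl

end ToField

/-! ### Half-integral matrices as integral quadratic forms -/

section SymmForm

variable {ν σ ρ : Type*}

/-- The symmetric matrix over `F` of the integral quadratic form with coefficient matrix `D`. -/
def symmForm (D : Matrix ν ν 𝒪[F]) : Matrix ν ν F :=
  (2⁻¹ : F) • (toField D + (toField D)ᵀ)

lemma symmForm_apply (D : Matrix ν ν 𝒪[F]) (i j : ν) :
    symmForm D i j = (2⁻¹ : F) * ((D i j : F) + D j i) := rfl

lemma symmForm_sub (D D' : Matrix ν ν 𝒪[F]) : symmForm (D - D') = symmForm D - symmForm D' := by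
  ext i j
  simp only [symmForm_apply, Matrix.sub_apply, AddSubgroupClass.coe_sub]
  ring

lemma smul_symmForm (x : 𝒪[F]) (D : Matrix ν ν 𝒪[F]) :
    (x : F) • symmForm D = symmForm (x • D) := by
  ext i j
  simp only [symmForm_apply, Matrix.smul_apply, smul_eq_mul, MulMemClass.coe_mul]
  ring

lemma act_blockForm_fromRows_one [Fintype σ] [DecidableEq σ] [Fintype ρ] (D : Matrix σ σ 𝒪[F])
    (R : Matrix ρ σ 𝒪[F]) (C : Matrix ρ ρ 𝒪[F]) (x : Matrix ρ σ 𝒪[F]) :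
    act (blockForm (symmForm D) R (symmForm C)) (toField (fromRows 1 x)) =
      symmForm (D + (xᵀ * R + xᵀ * C * x)) := by
  rw [toField_fromRows_one, act, blockForm, Matrix.mul_assoc, fromBlocks_mul_fromRows,
    transpose_fromRows, fromCols_mul_fromRows]
  simp only [symmForm, toField_add, toField_mul, toField_transpose, transpose_add, transpose_mul,
    transpose_transpose, transpose_one, Matrix.one_mul, Matrix.mul_one, smul_add, Matrix.mul_add,
    Matrix.add_mul, Matrix.smul_mul, Matrix.mul_smul, Matrix.mul_assoc]
  abel

variable [CharZero F]

lemma symmForm_diag (D : Matrix ν ν 𝒪[F]) (i : ν) : symmForm D i i = D i i := by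
  rw [symmForm_apply]
  ring

lemma two_mul_symmForm_apply (D : Matrix ν ν 𝒪[F]) (i j : ν) :
    2 * symmForm D i j = (D i j : F) + D j i := by
  rw [symmForm_apply, mul_inv_cancel_left₀ two_ne_zero]

/-- The upper triangular matrix with the diagonal of `T` and its doubled off-diagonal entries is
integral, so every denominator 2 is confined to `symmForm`. -/
lemma exists_symmForm_eq {T : Matrix ν ν F} (hT : T ∈ halfIntegral F ν) :
    ∃ D : Matrix ν ν 𝒪[F], symmForm D = T := by
  classical
  obtain ⟨h1, h2, h3⟩ := hT
  let : LinearOrder ν := IsWellOrder.linearOrder WellOrderingRel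
  refine ⟨of fun i j => if h : i = j then ⟨T i i, h2 i⟩ else
    if i < j then ⟨2 * T i j, h3 i j h⟩ else 0, ?_⟩
  ext i j
  rw [symmForm_apply]
  rcases lt_trichotomy i j with h | rfl | h
  · simp [h, h.ne, h.ne', h.not_gt]
  · simp only [of_apply, dif_pos]
    ring
  · simp [h, h.ne, h.ne', h.not_gt, h1.apply]

/-- Both sides say that `ϖ ^ e` divides the coefficients of the quadratic form. This turns the
defining congruences into equations over the quotient ring. -/
lemma symmForm_mem_scaledHalfIntegral_iff {ϖ : 𝒪[F]} (hϖ : ϖ ≠ 0) (e : ℕ)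
    (D : Matrix ν ν 𝒪[F]) :
    symmForm D ∈ scaledHalfIntegral ϖ e ν ↔ FormEq (D.map (levelMap ϖ e)) 0 := by
  have hdvd : FormEq (D.map (levelMap ϖ e)) 0 ↔
      (∀ i, ϖ ^ e ∣ D i i) ∧ ∀ i j, i ≠ j → ϖ ^ e ∣ D i j + D j i := by
    simp only [formEq_iff, Matrix.map_apply, Matrix.zero_apply, add_zero, ← map_add,
      levelMap_eq_zero_iff]
  have hϖ' : (ϖ : F) ^ e ≠ 0 := pow_ne_zero _ (by simpa using hϖ)
  rw [hdvd]
  constructor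
  · rintro ⟨C, ⟨-, h2, h3⟩, h⟩
    refine ⟨fun i => ⟨⟨C i i, h2 i⟩, Subtype.ext ?_⟩, fun i j hij => ⟨⟨2 * C i j, h3 i j hij⟩,
      Subtype.ext ?_⟩⟩
    · rw [← symmForm_diag, h]
      simp
    · push_cast
      rw [← two_mul_symmForm_apply, h, Matrix.smul_apply, smul_eq_mul]
      ring
  · rintro ⟨h1, h2⟩
    refine ⟨((ϖ : F) ^ e)⁻¹ • symmForm D, ⟨?_, fun i => ?_, fun i j hij => ?_⟩, ?_⟩
    · ext i j
      simp only [transpose_apply, Matrix.smul_apply, symmForm_apply, add_comm]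
    · obtain ⟨x, hx⟩ := h1 i
      rw [Matrix.smul_apply, symmForm_diag, hx]
      simp [hϖ', x.2]
    · obtain ⟨x, hx⟩ := h2 i j hij
      rw [Matrix.smul_apply, smul_eq_mul, mul_left_comm, two_mul_symmForm_apply,
        ← AddMemClass.coe_add, hx]
      simp [hϖ', x.2]
    · rw [smul_smul, mul_inv_cancel₀ hϖ', one_smul]

lemma formEq_map_sub_zero {R R' : Type*} [CommRing R] [CommRing R'] (f : R →+* R')
    (D D' : Matrix ν ν R) : FormEq ((D - D').map f) 0 ↔ FormEq (D.map f) (D'.map f) := by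
  rw [Matrix.map_sub f f.map_sub, ← formEq_add_right (E := D'.map f), sub_add_cancel, zero_add]

lemma act_hyperbolic {k : ℕ} (X : Matrix (Fin 2 × Fin k) ν 𝒪[F]) :
    act (hyperbolic F k) (toField X) = symmForm ((topRows X)ᵀ * botRows X) := by
  have h : hyperbolic F k * toField X =
      of fun p j => (2⁻¹ : F) * toField X (if p.1 = 0 then 1 else 0, p.2) j := by
    ext ⟨i, l⟩ j
    fin_cases i <;>
    simp [hyperbolic, Matrix.mul_apply, Fintype.sum_prod_type, blockDiagonal_apply]
  rw [act, Matrix.mul_assoc, h]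
  ext i j
  rw [symmForm_apply]
  simp only [Matrix.mul_apply, Fintype.sum_prod_type, Fin.sum_univ_two,
    AddSubmonoidClass.coe_finsetSum, ← Finset.sum_add_distrib, Finset.mul_sum]
  refine Finset.sum_congr rfl fun l _ => ?_
  simp [toField, topRows, botRows]
  ring

lemma act_blockForm_fromBlocks [Fintype σ] [DecidableEq σ] [Fintype ρ] [DecidableEq ρ]
    (ϖ : 𝒪[F]) (D : Matrix σ σ 𝒪[F]) (R : Matrix ρ σ 𝒪[F]) (C : Matrix ρ ρ 𝒪[F]) :
    act (blockForm (symmForm D) R (symmForm C)) (fromBlocks 1 0 0 ((ϖ : F) • 1)) =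
      symmForm (fromBlocks D 0 (ϖ • R) (ϖ ^ 2 • C)) := by
  rw [act, blockForm, fromBlocks_transpose, fromBlocks_multiply, fromBlocks_multiply]
  ext (i | i) (j | j) <;>
  simp [symmForm_apply, toField] <;> ring

end SymmForm

/-! ### From volumes to counts modulo powers of the prime element -/

section Reduction

lemma isOpen_setOf_entries_mem {M ι κ : Type*} [TopologicalSpace M] [Finite ι] [Finite κ]
    {S : Set M} (hS : IsOpen S) :
    IsOpen {X : Matrix ι κ M | ∀ i j, X i j ∈ S} := by
  simp only [Set.ofPred_forall]
  exact isOpen_iInter_of_finite fun i => isOpen_iInter_of_finite fun j =>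
    hS.preimage (continuous_id.matrix_elem i j)

variable {ν σ ρ : Type*}

/-- Reduction modulo `ϖ ^ e` of a system of vectors in the hyperbolic space. -/
def reduceHyp (ϖ : 𝒪[F]) (e k : ℕ) (ν : Type*) : Matrix (Fin 2 × Fin k) ν 𝒪[F] →+
    Matrix (Fin k) ν (𝒪[F] ⧸ Ideal.span {ϖ ^ e}) × Matrix (Fin k) ν (𝒪[F] ⧸ Ideal.span {ϖ ^ e}) :=
  AddMonoidHom.mk' (fun X => ((topRows X).map (levelMap ϖ e), (botRows X).map (levelMap ϖ e)))
    fun X Y => by ext <;> simp [topRows, botRows]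

lemma reduceHyp_surjective (ϖ : 𝒪[F]) (e k : ℕ) (ν : Type*) :
    Function.Surjective (reduceHyp ϖ e k ν) := by
  rintro ⟨a, b⟩
  have h := levelMap_surjective ϖ e
  refine ⟨of fun p j => if p.1 = 0 then Function.surjInv h (a p.2 j) else
    Function.surjInv h (b p.2 j), Prod.ext ?_ ?_⟩ <;>
  · ext i j
    simpa [reduceHyp, topRows, botRows] using Function.surjInv_eq h _

/-- Reduction modulo `ϖ ^ e` of the pairs of matrices in `modifiedSet`. -/
def reducePair (ϖ : 𝒪[F]) (e k : ℕ) (σ ρ : Type*) :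
    Matrix (Fin 2 × Fin k) σ 𝒪[F] × Matrix ρ σ 𝒪[F] →+
    (Matrix (Fin k) σ (𝒪[F] ⧸ Ideal.span {ϖ ^ e}) ×
      Matrix (Fin k) σ (𝒪[F] ⧸ Ideal.span {ϖ ^ e})) × Matrix ρ σ (𝒪[F] ⧸ Ideal.span {ϖ ^ e}) :=
  (reduceHyp ϖ e k σ).prodMap (levelMap ϖ e).toAddMonoidHom.mapMatrix

lemma reducePair_surjective (ϖ : 𝒪[F]) (e k : ℕ) (σ ρ : Type*) :
    Function.Surjective (reducePair ϖ e k σ ρ) := by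
  rintro ⟨y, x⟩
  have h := levelMap_surjective ϖ e
  obtain ⟨X, rfl⟩ := reduceHyp_surjective ϖ e k σ y
  refine ⟨(X, x.map (Function.surjInv h)), Prod.ext rfl ?_⟩
  ext i j
  exact Function.surjInv_eq h _

lemma modifiedSet_eq [CharZero F] {ϖ : 𝒪[F]} [Fintype σ] [DecidableEq σ] [Fintype ρ]
    (hϖ : Irreducible ϖ) (e k : ℕ)
    (D : Matrix σ σ 𝒪[F]) (R : Matrix ρ σ 𝒪[F]) (C : Matrix ρ ρ 𝒪[F]) :
    modifiedSet ϖ e (hyperbolic F k) (symmForm D) R (symmForm C) =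
      reducePair ϖ e k σ ρ ⁻¹' shiftedSet (Fin k) (D.map (levelMap ϖ e)) (R.map (levelMap ϖ e))
        (C.map (levelMap ϖ e)) := by
  ext X
  rw [modifiedSet, Set.mem_ofPred_eq, act_hyperbolic, act_blockForm_fromRows_one, ← symmForm_sub,
    symmForm_mem_scaledHalfIntegral_iff hϖ.ne_zero, formEq_map_sub_zero]
  rw [Matrix.map_mul, Matrix.map_add _ (map_add _), Matrix.map_add _ (map_add _), Matrix.map_mul,
    Matrix.map_mul, Matrix.map_mul]
  rfl

variable [TopologicalSpace F] [IsNonarchimedeanLocalField F] {ϖ : 𝒪[F]}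

/-- An ideal of the ring of integers is closed, and this one has finite index, so it is open. -/
lemma isOpen_span_pow (hϖ : Irreducible ϖ) (e : ℕ) :
    IsOpen ((Ideal.span {ϖ ^ e} : Ideal 𝒪[F]) : Set 𝒪[F]) := by
  let := IsTopologicalAddGroup.rightUniformSpace F
  have := isUniformAddGroup_of_addCommGroup (G := F)
  have hfin : Finite (𝒪[F] ⧸ (Ideal.span {ϖ ^ e} : Ideal 𝒪[F]).toAddSubgroup) :=
    finite_level hϖ e
  have : (Ideal.span {ϖ ^ e} : Ideal 𝒪[F]).toAddSubgroup.FiniteIndex :=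
    AddSubgroup.finiteIndex_of_finite_quotient
  have hc : IsClosed ((Ideal.span {ϖ ^ e} : Ideal 𝒪[F]) : Set 𝒪[F]) :=
    IsNoetherianRing.isClosed_ideal _
  exact AddSubgroup.isOpen_of_isClosed_of_finiteIndex
    (Ideal.span {ϖ ^ e} : Ideal 𝒪[F]).toAddSubgroup hc

lemma isOpen_ker_reduceHyp [Finite ν] (hϖ : Irreducible ϖ) (e k : ℕ) :
    IsOpen ((reduceHyp ϖ e k ν).ker : Set (Matrix (Fin 2 × Fin k) ν 𝒪[F])) := by
  convert isOpen_setOf_entries_mem (ι := Fin 2 × Fin k) (κ := ν) (isOpen_span_pow hϖ e) using 1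
  ext X
  simp only [SetLike.mem_coe, AddMonoidHom.mem_ker, Set.mem_ofPred_eq, Prod.forall,
    Fin.forall_fin_two, ← Ideal.Quotient.eq_zero_iff_mem]
  exact Prod.ext_iff.trans (and_congr Matrix.ext_iff.symm Matrix.ext_iff.symm)

lemma isOpen_ker_reducePair [Finite σ] [Finite ρ] (hϖ : Irreducible ϖ) (e k : ℕ) :
    IsOpen ((reducePair ϖ e k σ ρ).ker :
      Set (Matrix (Fin 2 × Fin k) σ 𝒪[F] × Matrix ρ σ 𝒪[F])) := by
  convert (isOpen_ker_reduceHyp (ν := σ) hϖ e k).prod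
    (isOpen_setOf_entries_mem (ι := ρ) (κ := σ) (isOpen_span_pow hϖ e)) using 1
  ext X
  simp only [SetLike.mem_coe, AddMonoidHom.mem_ker, Set.mem_prod, Set.mem_ofPred_eq,
    ← Ideal.Quotient.eq_zero_iff_mem]
  exact Prod.ext_iff.trans (and_congr_right fun _ => Matrix.ext_iff.symm)

variable [CharZero F]

/-- Level 0 must be excluded: over the zero ring every matrix has a left inverse, so primitivity
would not be detected. -/
lemma primitiveSet_eq [Fintype ν] [Fintype ρ] [DecidableEq ρ] (hϖ : Irreducible ϖ) {e : ℕ}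
    (he : 1 ≤ e) (k : ℕ) (D : Matrix ν ν 𝒪[F]) (c : ρ → ν) :
    primitiveSet ϖ e (hyperbolic F k) (symmForm D) c =
      reduceHyp ϖ e k ν ⁻¹' solutionSet (Fin k) (D.map (levelMap ϖ e)) c := by
  have := isLocalRing_level hϖ he
  have := IsLocalHom.of_surjective (levelMap ϖ e) (levelMap_surjective ϖ e)
  ext X
  refine and_congr ?_ ?_
  · rw [act_hyperbolic, ← symmForm_sub, symmForm_mem_scaledHalfIntegral_iff hϖ.ne_zero,
      formEq_map_sub_zero, Matrix.map_mul]
    rfl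
  · rw [isPrimitive_iff_hasLeftInverse, ← hasLeftInverse_topRows_botRows,
      ← hasLeftInverse_map_iff (levelMap ϖ e) (levelMap_surjective ϖ e)]
    refine iff_of_eq (congrArg HasLeftInverse ?_)
    ext (i | i) j <;> rfl

lemma primitiveVol_eq_normCount [Fintype ν] [Fintype ρ] [DecidableEq ρ] (hϖ : Irreducible ϖ)
    {e : ℕ} (he : 1 ≤ e) (k : ℕ) (D : Matrix ν ν 𝒪[F]) (c : ρ → ν) :
    primitiveVol ϖ (hyperbolic F k) (symmForm D) c e = normCount (Fin k) ϖ D c e := by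
  have := finite_level hϖ e
  rw [primitiveVol, primitiveSet_eq hϖ he,
    vol_preimage _ (reduceHyp_surjective ϖ e k ν) (isOpen_ker_reduceHyp hϖ e k)]
  rfl

lemma card_matrix {L ι κ : Type*} [Fintype ι] [Fintype κ] :
    Nat.card (Matrix ι κ L) = Nat.card L ^ (Fintype.card ι * Fintype.card κ) := by
  rw [Nat.card_congr Matrix.of.symm, Nat.card_fun, Nat.card_fun, ← pow_mul,
    Nat.card_eq_fintype_card (α := ι), Nat.card_eq_fintype_card (α := κ), mul_comm]

lemma triangle_add (a b : ℕ) :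
    (a + b) * (a + b + 1) / 2 = a * (a + 1) / 2 + b * (b + 1) / 2 + a * b := by
  have h1 := Nat.div_two_mul_two_of_even (Nat.even_mul_succ_self a)
  have h2 := Nat.div_two_mul_two_of_even (Nat.even_mul_succ_self b)
  refine Nat.div_eq_of_eq_mul_left two_pos ?_
  linear_combination -h1 - h2

/-- The factorization of densities at a finite level. -/
lemma normCount_fromBlocks (hϖ : Irreducible ϖ) {e : ℕ} (he : 1 ≤ e) {s r k : ℕ} (hk : r ≤ k)
    (D : Matrix (Fin s) (Fin s) 𝒪[F]) (R : Matrix (Fin r) (Fin s) 𝒪[F])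
    {C : Matrix (Fin r) (Fin r) 𝒪[F]} (hC : ∀ i j, ϖ ∣ C i j) :
    normCount (Fin k) ϖ (fromBlocks D 0 R C) (Sum.inr : Fin r → Fin s ⊕ Fin r) e =
      normCount (Fin k) ϖ C (id : Fin r → Fin r) e *
        modifiedVol ϖ (hyperbolic F (k - r)) (symmForm D) R (symmForm C) e := by
  have := finite_level hϖ e
  have := isLocalRing_level hϖ he
  have hC0 : ∀ i j, (C.map (levelMap ϖ e)) i j ∈ IsLocalRing.maximalIdeal _ := fun i j => by
    obtain ⟨x, hx⟩ := hC i j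
    rw [Matrix.map_apply, hx, map_mul]
    exact Ideal.mul_mem_right _ _ (levelMap_mem_maximalIdeal hϖ)
  have key := card_solutionSet_fromBlocks (κ := Fin k) (D.map (levelMap ϖ e))
    (R.map (levelMap ϖ e)) hC0
  rw [Fintype.card_fin, Fintype.card_fin] at key
  have hB : (fromBlocks D 0 R C).map (levelMap ϖ e) = fromBlocks (D.map (levelMap ϖ e)) 0
      (R.map (levelMap ϖ e)) (C.map (levelMap ϖ e)) := by
    rw [fromBlocks_map, Matrix.map_zero _ (map_zero _)]
  rw [modifiedVol, modifiedSet_eq hϖ,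
    vol_preimage _ (reducePair_surjective ϖ e _ _ _) (isOpen_ker_reducePair hϖ e _), normCount,
    normCount, hB, key]
  simp only [Nat.card_prod, card_matrix, card_level hϖ, Fintype.card_sum, Fintype.card_fin,
    triangle_add]
  obtain ⟨l, rfl⟩ := Nat.exists_eq_add_of_le hk
  rw [Nat.add_sub_cancel_left]
  have hq : (Nat.card 𝓀[F] : ℝ) ≠ 0 := Nat.cast_ne_zero.mpr Nat.card_pos.ne'
  push_cast
  -- The powers of `q` balance: the cross term `s * r` of `triangle_add` equals the `2 * r * s`
  -- coordinates lost in passing from `H_k` to `H_{k-r}`, less the `r * s` entries of the extra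
  -- matrix in `α`.
  rw [← mul_div_assoc, ← mul_div_assoc, ← mul_div_assoc, div_mul_div_comm, div_eq_div_iff
    (by positivity) (by positivity)]
  ring

end Reduction

/-! ### Existence of the limits -/

section Limits

open Filter Topology

variable [TopologicalSpace F] [IsNonarchimedeanLocalField F] {ϖ : 𝒪[F]}

lemma tendsto_of_eventually_eq {f : ℕ → ℝ} {x : ℝ} {n : ℕ} (h : ∀ e, n ≤ e → f e = x) :
    Tendsto f atTop (𝓝 x) :=
  tendsto_const_nhds.congr' <| (eventually_ge_atTop n).mono fun e he => (h e he).symm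

/-- Since `r ≤ k`, a primitive representation always exists. This permits division by the normalized
count of `β`. -/
lemma normCount_primitive_ne_zero (hϖ : Irreducible ϖ) {r k : ℕ} (hk : r ≤ k)
    (C : Matrix (Fin r) (Fin r) 𝒪[F]) (e : ℕ) :
    normCount (Fin k) ϖ C (id : Fin r → Fin r) e ≠ 0 := by
  have := finite_level hϖ e
  have hne := (solutionSet_nonempty (Fin.castLEEmb hk) (C.map (levelMap ϖ e))).to_subtype
  exact mul_ne_zero (pow_ne_zero _ (Nat.cast_ne_zero.mpr Nat.card_pos.ne'))
    (div_ne_zero (Nat.cast_ne_zero.mpr Nat.card_pos.ne') (Nat.cast_ne_zero.mpr Nat.card_pos.ne'))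

variable [CharZero F]

lemma exists_det_dvd_pow {ν : Type*} [Fintype ν] [DecidableEq ν] (hϖ : Irreducible ϖ)
    {D : Matrix ν ν 𝒪[F]} (hD : (symmForm D).det ≠ 0) : ∃ d, (D + Dᵀ).det ∣ ϖ ^ d := by
  have h : toField (D + Dᵀ) = (2 : F) • symmForm D := by
    rw [symmForm, smul_smul, mul_inv_cancel₀ two_ne_zero, one_smul, toField_add, toField_transpose]
  have h' : (D + Dᵀ).det ≠ 0 := by
    intro h0
    have h1 : (toField (D + Dᵀ)).det = 0 := by
      rw [toField_eq_map, ← RingHom.mapMatrix_apply, ← RingHom.map_det, h0, map_zero]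
    rw [h, det_smul] at h1
    exact mul_ne_zero (pow_ne_zero _ two_ne_zero) hD h1
  obtain ⟨d, hd⟩ := IsDiscreteValuationRing.associated_pow_irreducible h' hϖ
  exact ⟨d, hd.dvd⟩

end Limits

end LocalDensity

end

open LocalDensity Matrix Filter Topology in
theorem theorem5p1 {F : Type*} [Field F] [ValuativeRel F] [TopologicalSpace F]
    [IsNonarchimedeanLocalField F] [CharZero F] (ϖ : 𝒪[F]) (hϖ : Irreducible ϖ)
    (s r k : ℕ) (hk : r ≤ k)
    (T : Matrix (Fin s) (Fin s) F) (hT : T ∈ halfIntegral F (Fin s))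
    (R : Matrix (Fin r) (Fin s) 𝒪[F])
    (A : Matrix (Fin r) (Fin r) F) (hA : A ∈ halfIntegral F (Fin r))
    (hB : (blockForm T R A).det ≠ 0) :
    -- the limit defining `α(H_{k-r}, T, ϖR, ϖ²A)` exists
    Tendsto (modifiedVol ϖ (hyperbolic F (k - r)) T (ϖ • R) ((ϖ : F) ^ 2 • A)) atTop
      (𝓝 (modifiedDensity ϖ (hyperbolic F (k - r)) T (ϖ • R) ((ϖ : F) ^ 2 • A))) ∧
    -- the limit defining `β(H_k, ϖ²A)` exists
    Tendsto (primitiveVol ϖ (hyperbolic F k) ((ϖ : F) ^ 2 • A) (id : Fin r → Fin r)) atTop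
      (𝓝 (primitiveDensity ϖ (hyperbolic F k) ((ϖ : F) ^ 2 • A) (id : Fin r → Fin r))) ∧
    -- the limit defining `β(H_k, B[1_{n-r} ⊥ ϖ1_r])^{(r)}` exists
    Tendsto (primitiveVol ϖ (hyperbolic F k)
        (act (blockForm T R A) (fromBlocks 1 0 0 ((ϖ : F) • 1)))
        (Sum.inr : Fin r → Fin s ⊕ Fin r)) atTop
      (𝓝 (primitiveDensity ϖ (hyperbolic F k)
        (act (blockForm T R A) (fromBlocks 1 0 0 ((ϖ : F) • 1)))
        (Sum.inr : Fin r → Fin s ⊕ Fin r))) ∧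
    primitiveDensity ϖ (hyperbolic F k)
        (act (blockForm T R A) (fromBlocks 1 0 0 ((ϖ : F) • 1)))
        (Sum.inr : Fin r → Fin s ⊕ Fin r) =
      primitiveDensity ϖ (hyperbolic F k) ((ϖ : F) ^ 2 • A) (id : Fin r → Fin r) *
        modifiedDensity ϖ (hyperbolic F (k - r)) T (ϖ • R) ((ϖ : F) ^ 2 • A) := by
  obtain ⟨D, rfl⟩ := exists_symmForm_eq hT
  obtain ⟨C, rfl⟩ := exists_symmForm_eq hA
  have hϖ0 : (ϖ : F) ≠ 0 := by simpa using hϖ.ne_zero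
  have hdet : (act (blockForm (symmForm D) R (symmForm C))
      (fromBlocks 1 0 0 ((ϖ : F) • 1) : Matrix (Fin s ⊕ Fin r) (Fin s ⊕ Fin r) F)).det ≠ 0 := by
    have h1 : (fromBlocks (1 : Matrix (Fin s) (Fin s) F) 0 0
        ((ϖ : F) • (1 : Matrix (Fin r) (Fin r) F))).det ≠ 0 := by
      rw [det_fromBlocks_zero₂₁, det_one, one_mul, det_smul, det_one, mul_one]
      exact pow_ne_zero _ hϖ0
    rw [act, det_mul, det_mul, det_transpose]
    exact mul_ne_zero (mul_ne_zero h1 hB) h1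
  rw [act_blockForm_fromBlocks] at hdet ⊢
  rw [show (ϖ : F) ^ 2 • symmForm C = symmForm (ϖ ^ 2 • C) from smul_symmForm (ϖ ^ 2) C]
  obtain ⟨d, hd⟩ := exists_det_dvd_pow hϖ hdet
  set C' := ϖ ^ 2 • C
  set E := fromBlocks D 0 (ϖ • R) C'
  -- The factor `ϖ ^ 2` enters the factorization only through this divisibility, which makes the
  -- last columns totally isotropic modulo `ϖ`.
  have hC' : ∀ i j, ϖ ∣ C' i j := fun i j => Dvd.intro (ϖ * C i j) (by simp [C']; ring)
  have hβ : ∀ e, 1 ≤ e → primitiveVol ϖ (hyperbolic F k) (symmForm C') id e =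
      normCount (Fin k) ϖ C' id 1 := fun e he => by
    rw [primitiveVol_eq_normCount hϖ he]
    exact eq_of_forall_succ_eq (fun e he => normCount_succ_of_primitive hϖ C' he) he
  have hE : ∀ e, 2 * d + 1 ≤ e → normCount (Fin k) ϖ E Sum.inr e =
      normCount (Fin k) ϖ E Sum.inr (2 * d + 1) := fun e he =>
    eq_of_forall_succ_eq (fun e he => normCount_succ_of_det_dvd hϖ E Sum.inr hd he) he
  have hβr : ∀ e, 2 * d + 1 ≤ e → primitiveVol ϖ (hyperbolic F k) (symmForm E) Sum.inr e =
      normCount (Fin k) ϖ E Sum.inr (2 * d + 1) := fun e he => by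
    rw [primitiveVol_eq_normCount hϖ (by omega), hE e he]
  have hne : normCount (Fin k) ϖ C' id 1 ≠ 0 := normCount_primitive_ne_zero hϖ hk C' 1
  -- No separate stability argument is needed for `α`: the identity at level `e` gives it as a
  -- quotient of two counts that are already constant.
  have hα : ∀ e, 2 * d + 1 ≤ e →
      modifiedVol ϖ (hyperbolic F (k - r)) (symmForm D) (ϖ • R) (symmForm C') e =
        normCount (Fin k) ϖ E Sum.inr (2 * d + 1) / normCount (Fin k) ϖ C' id 1 := fun e he => by
    rw [eq_div_iff hne, mul_comm, ← hE e he,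
      normCount_fromBlocks hϖ (by omega) hk D (ϖ • R) hC', ← hβ e (by omega),
      primitiveVol_eq_normCount hϖ (by omega)]
  have tα := tendsto_of_eventually_eq hα
  have tβ := tendsto_of_eventually_eq hβ
  have tβr := tendsto_of_eventually_eq hβr
  refine ⟨tendsto_nhds_limUnder ⟨_, tα⟩, tendsto_nhds_limUnder ⟨_, tβ⟩,
    tendsto_nhds_limUnder ⟨_, tβr⟩, ?_⟩
  rw [primitiveDensity, primitiveDensity, modifiedDensity, tα.limUnder_eq, tβ.limUnder_eq,
    tβr.limUnder_eq, mul_div_cancel₀ _ hne]
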